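/- \textbf{Theorem.} Setting. For $d\ge 0$ let $\mathcal A=\{a\in\mathbb R^{d+1}:\|a\|\le 1\}$ (Euclidean norm). In the linear bandit instance with parameter $\theta\in\mathbb R^{d+1}\setminus\{0\}$, in each round $t=1,\dots,T$ the learner plays $a_t\in\mathcal A$ and observes $y_t=\langle a_t,\theta\rangle+\xi_t$, where the $\xi_t$ are i.i.d. standard Gaussian. A learning algorithm is a (possibly randomised) measurable rule that chooses $a_t$ from $y_1,\dots,y_{t-1}$, its past actions and internal randomness independent of the noise. Put $a^\star_\theta=\theta/\|\theta\|$ and $$\operatorname{Reg}^\theta(T)=\sum_{t=1}^T\langle\theta,a^\star_\theta-a_t\rangle,\qquad \operatorname{Reg}^\theta_h(T)=\sum_{t=1}^T\langle\theta,h-a_t\rangle .$$ Claim. There are absolute constants $0<r_1\le r_2$ and $c>0$ such that the following holds for every $d\ge 0$, every horizon $T\ge 1$, every hint $h\in\mathbb R^{d+1}$ with $\|h\|=1$ and every learning algorithm. There is a finite nonempty family $\Theta\subset\mathbb R^{d+1}$ of parameters with $r_1\le\|\theta\|\le r_2$ for all $\theta\in\Theta$ such that $R_h:=\max_{\theta\in\Theta}\mathbb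 E[\operatorname{Reg}^\theta_h(T)]$ satisfies $R_h\ge 0$, and such that some $\theta\in\Theta$ satisfies $$\mathbb E[\operatorname{Reg}^\theta(T)]\ \ge\ \frac14+\frac T4\,\min\Bigl(1,\frac{d-1}{R_h}\Bigr),$$ where the minimum is read as $1$ if $R_h=0$; moreover, for the same $\theta$, if $R_h\ge d$ (and $R_h>0$) then $$\mathbb E[\operatorname{Reg}^\theta(T)]\ \ge\ c\,\frac{dT}{R_h},\qquad\text{that is,}\qquad R_h\cdot\mathbb E[\operatorname{Reg}^\theta(T)]\ \ge\ c\,dT .$$ -/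

import Mathlib

open MeasureTheory ProbabilityTheory

namespace HintBandit

/-- A (possibly randomised) learning algorithm for the unit ball of `ℝᵐ`. A random seed in `Ω` is
drawn once; in round `t` (rounds are numbered `0, 1, 2, …`) the action is a measurable function of
the seed and of the `t` rewards seen so far. (Past actions are functions of the same data.) -/
structure Algorithm (m : ℕ) (Ω : Type*) [MeasurableSpace Ω] where
  seedLaw : Measure Ω
  isProbabilityMeasure_seedLaw : IsProbabilityMeasure seedLaw
  action : (t : ℕ) → Ω → (Fin t → ℝ) → EuclideanSpace ℝ (Fin m)
  measurable_action : ∀ t, Measurable (fun p : Ω × (Fin t → ℝ) => action t p.1 p.2)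
  norm_action_le : ∀ t ω y, ‖action t ω y‖ ≤ 1

attribute [instance] Algorithm.isProbabilityMeasure_seedLaw

variable {m : ℕ} {Ω : Type*} [MeasurableSpace Ω]

/-- Appends to the seed and the first `t` rewards the reward of round `t`, which is
`⟪a_t, θ⟫ + ξ` where `a_t` is the action played and `ξ` is the noise. -/
noncomputable def step (alg : Algorithm m Ω) (θ : EuclideanSpace ℝ (Fin m)) (t : ℕ)
    (p : (Ω × (Fin t → ℝ)) × ℝ) : Ω × (Fin (t + 1) → ℝ) :=
  (p.1.1, Fin.snoc p.1.2 (inner ℝ (alg.action t p.1.1 p.1.2) θ + p.2))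

/-- The joint law of the seed and the first `t` rewards when the algorithm interacts with the
linear bandit with parameter `θ`: each round uses a fresh independent standard Gaussian noise. -/
noncomputable def interactionLaw (alg : Algorithm m Ω) (θ : EuclideanSpace ℝ (Fin m)) :
    (t : ℕ) → Measure (Ω × (Fin t → ℝ))
  | 0 => alg.seedLaw.map (fun ω => (ω, Fin.elim0))
  | t + 1 => ((interactionLaw alg θ t).prod (gaussianReal 0 1)).map (step alg θ t)

/-- The action of round `t < T`, as a function of the seed and of all `T` rewards (it looks at the
first `t` rewards only). -/
noncomputable def actionAt (alg : Algorithm m Ω) {T : ℕ} (t : Fin T) (p : Ω × (Fin T → ℝ)) :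
    EuclideanSpace ℝ (Fin m) :=
  alg.action t p.1 (fun i => p.2 (Fin.castLE t.is_lt.le i))

/-- The (pseudo-)regret after `T` rounds relative to always playing the action `b`, in the instance
with parameter `θ`. -/
noncomputable def regretAgainst (alg : Algorithm m Ω) (θ b : EuclideanSpace ℝ (Fin m)) (T : ℕ)
    (p : Ω × (Fin T → ℝ)) : ℝ :=
  ∑ t : Fin T, inner ℝ θ (b - actionAt alg t p)

/-- The expected hint-based regret for the hint `h`. -/
noncomputable def expectedHintRegret (alg : Algorithm m Ω) (h θ : EuclideanSpace ℝ (Fin m))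
    (T : ℕ) : ℝ :=
  ∫ p, regretAgainst alg θ h T p ∂(interactionLaw alg θ T)

/-- The optimal action `θ / ‖θ‖` of the unit ball, for `θ ≠ 0`. -/
noncomputable def optimalAction (θ : EuclideanSpace ℝ (Fin m)) : EuclideanSpace ℝ (Fin m) :=
  ‖θ‖⁻¹ • θ

/-- The expected regret relative to the optimal action. -/
noncomputable def expectedRegret (alg : Algorithm m Ω) (θ : EuclideanSpace ℝ (Fin m))
    (T : ℕ) : ℝ :=
  ∫ p, regretAgainst alg θ (optimalAction θ) T p ∂(interactionLaw alg θ T)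

theorem measurable_step (alg : Algorithm m Ω) (θ : EuclideanSpace ℝ (Fin m)) (t : ℕ) :
    Measurable (step alg θ t) := by
  unfold step
  refine (measurable_fst.comp measurable_fst).prodMk ?_
  refine measurable_pi_lambda _ (fun i => ?_)
  have hact : Measurable (fun p : (Ω × (Fin t → ℝ)) × ℝ => alg.action t p.1.1 p.1.2) :=
    (alg.measurable_action t).comp measurable_fst
  have hlast : Measurable (fun p : (Ω × (Fin t → ℝ)) × ℝ =>
      inner ℝ (alg.action t p.1.1 p.1.2) θ + p.2) :=
    (hact.inner measurable_const).add measurable_snd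
  refine Fin.lastCases ?_ (fun j => ?_) i
  · simpa using hlast
  · simpa [Function.comp_def] using (measurable_pi_apply j).comp (measurable_snd.comp measurable_fst)

instance isProbabilityMeasure_interactionLaw (alg : Algorithm m Ω)
    (θ : EuclideanSpace ℝ (Fin m)) (t : ℕ) :
    IsProbabilityMeasure (interactionLaw alg θ t) := by
  induction t with
  | zero =>
    exact Measure.isProbabilityMeasure_map
      (measurable_id.prodMk measurable_const).aemeasurable
  | succ t ih =>
    exact Measure.isProbabilityMeasure_map (measurable_step alg θ t).aemeasurable

theorem measurable_actionAt (alg : Algorithm m Ω) {T : ℕ} (t : Fin T) :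
    Measurable (actionAt alg t) :=
  (alg.measurable_action t).comp (measurable_fst.prodMk (measurable_pi_lambda _
    (fun i => (measurable_pi_apply (Fin.castLE t.is_lt.le i)).comp measurable_snd)))

/-- The integrals above are genuine expectations: the regret is bounded and measurable. -/
theorem integrable_regretAgainst (alg : Algorithm m Ω) (θ b : EuclideanSpace ℝ (Fin m)) (T : ℕ) :
    Integrable (regretAgainst alg θ b T) (interactionLaw alg θ T) := by
  unfold regretAgainst
  refine integrable_finsetSum _ (fun t _ => ?_)
  refine Integrable.of_bound (C := ‖θ‖ * (‖b‖ + 1)) ?_ (Filter.Eventually.of_forall fun p => ?_)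
  · exact (measurable_const.inner
      (measurable_const.sub (measurable_actionAt alg t))).aestronglyMeasurable
  · refine (norm_inner_le_norm _ _).trans (mul_le_mul_of_nonneg_left ?_ (norm_nonneg _))
    exact (norm_sub_le _ _).trans (add_le_add_right (alg.norm_action_le _ _ _) _)

end HintBandit

/-!
Fix a scale `r`. Under the parameter `r • h` every unit of energy that the actions spend
orthogonally to `h` costs regret `r / 2`, so among `d` orthogonal directions one, `e`, receives
little energy. Perturb the parameter to `r • (h ± ρ • e)`: staying near `h` now loses a constant
times `r * ρ ^ 2` per round, and an algorithm can do better only if it distinguishes the two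
perturbations from each other and from `r • h`, which the energy along `e` limits.

The sharp constant `1 / 4` in the theorem rules out the usual lossy information inequalities. In
each round the three losses bound a Bayes risk, an explicit function of the two likelihood ratios.
This risk dominates, up to a multiple of a mean-zero term, the logarithm of an explicit
`certificate`. Along the interaction that logarithm is a function of energy and score, and these
move like the clock and the position of a Brownian motion; it satisfies a heat-type inequality and
hence decreases in mean at most linearly in the energy. The resulting constant `711 / 1000` is large
enough because `2 * (711 / 1000) ^ 2 > 1`, which leaves room for the lower-order errors.

Both `r • h` and `-(r • h)` belong to the family as well: the first action cannot suit both, which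
gives regret at least `r` and absorbs all additive constants.
-/

namespace HintBandit

section Gaussian

variable {μ : ℝ} {v : NNReal}

theorem hasDerivAt_gaussianPDFReal (x : ℝ) :
    HasDerivAt (gaussianPDFReal μ v) (-((x - μ) / v) * gaussianPDFReal μ v x) x := by
  have hexponent : HasDerivAt (fun y : ℝ => -(y - μ) ^ 2 / (2 * v)) (-((x - μ) / v)) x := by
    refine ((((hasDerivAt_id x).sub_const μ).pow 2).neg.div_const (2 * (v : ℝ))).congr_deriv ?_
    simp only [id_eq, Nat.cast_ofNat, Nat.add_one_sub_one, pow_one, mul_one, neg_div]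
    rw [mul_div_mul_left _ _ two_ne_zero]
  refine (hexponent.exp.const_mul (√(2 * Real.pi * v))⁻¹).congr_deriv ?_
  simp only [gaussianPDFReal]
  ring

theorem integrable_gaussianPDFReal_smul (hv : v ≠ 0) {f : ℝ → ℝ}
    (hf : Integrable f (gaussianReal μ v)) :
    Integrable fun x => gaussianPDFReal μ v x • f x := by
  rw [gaussianReal_of_var_ne_zero _ hv, integrable_withDensity_iff_integrable_smul'
    (measurable_gaussianPDF μ v) (ae_of_all _ fun _ => gaussianPDF_lt_top)] at hf
  simpa only [toReal_gaussianPDF] using hf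

theorem integral_sub_mul_gaussianReal {φ φ' : ℝ → ℝ} (hderiv : ∀ x, HasDerivAt φ (φ' x) x)
    (hφ : Integrable φ (gaussianReal μ v)) (hφ' : Integrable φ' (gaussianReal μ v))
    (hxφ : Integrable (fun x => (x - μ) * φ x) (gaussianReal μ v)) :
    ∫ x, (x - μ) * φ x ∂(gaussianReal μ v) = v * ∫ x, φ' x ∂(gaussianReal μ v) := by
  obtain rfl | hv := eq_or_ne v 0
  · simp
  have hv' : (v : ℝ) ≠ 0 := NNReal.coe_ne_zero.2 hv
  have hprimitive : ∀ x, HasDerivAt (fun y => -(v * (gaussianPDFReal μ v y • φ y)))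
      (gaussianPDFReal μ v x • ((x - μ) * φ x - v * φ' x)) x := fun x => by
    refine (((hasDerivAt_gaussianPDFReal x).smul (hderiv x)).const_mul (v : ℝ)).neg.congr_deriv ?_
    simp only [smul_eq_mul]
    field_simp
    ring
  rw [← integral_const_mul, ← sub_eq_zero, ← integral_sub hxφ (hφ'.const_mul _),
    integral_gaussianReal_eq_integral_smul hv]
  exact integral_eq_zero_of_hasDerivAt_of_integrable hprimitive
    (integrable_gaussianPDFReal_smul hv (hxφ.sub (hφ'.const_mul _)))
    ((integrable_gaussianPDFReal_smul hv hφ).const_mul _).neg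

theorem gaussianReal_add_eq_withDensity (hv : v ≠ 0) (δ : ℝ) :
    gaussianReal (μ + δ) v = (gaussianReal μ v).withDensity fun x =>
      ENNReal.ofReal (Real.exp ((δ * (x - μ) - δ ^ 2 / 2) / v)) := by
  have hv' : (v : ℝ) ≠ 0 := NNReal.coe_ne_zero.2 hv
  rw [gaussianReal_of_var_ne_zero _ hv, gaussianReal_of_var_ne_zero _ hv,
    ← withDensity_mul _ (measurable_gaussianPDF μ v) (by fun_prop)]
  congr 1 with x
  rw [Pi.mul_apply, gaussianPDF, gaussianPDF, ← ENNReal.ofReal_mul (gaussianPDFReal_nonneg _ _ _)]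
  simp only [gaussianPDFReal, mul_assoc, ← Real.exp_add]
  congr 3
  field_simp
  ring

theorem lintegral_gaussianReal_comp_add_const (hv : v ≠ 0) (δ : ℝ) {F : ℝ → ENNReal}
    (hF : Measurable F) :
    ∫⁻ x, F (x + δ) ∂(gaussianReal μ v) =
      ∫⁻ x, ENNReal.ofReal (Real.exp ((δ * (x - μ) - δ ^ 2 / 2) / v)) * F x
        ∂(gaussianReal μ v) := by
  rw [← lintegral_map hF (measurable_add_const δ), gaussianReal_map_add_const,
    gaussianReal_add_eq_withDensity hv, lintegral_withDensity_eq_lintegral_mul _ (by fun_prop) hF]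
  rfl

theorem integrable_abs_gaussianReal : Integrable (fun x => |x|) (gaussianReal μ v) :=
  ((memLp_id_gaussianReal 1).integrable le_rfl).abs

end Gaussian

/-- `K` is a function of time and space with derivatives `Kx` in time and `Kw`, `Kww` in space
bounded by `B` and such that, for times `y ≥ 0`, the drift `Kx + Kww / 2` of `K y W_y` along a
Brownian motion `W` is nonnegative. -/
structure IsHeatSubsolution (K Kx Kw Kww : ℝ → ℝ → ℝ) (B : ℝ) : Prop where
  hasFDerivAt : ∀ y w, 0 ≤ y → HasFDerivAt (Function.uncurry K)
    (Kx y w • ContinuousLinearMap.fst ℝ ℝ ℝ + Kw y w • ContinuousLinearMap.snd ℝ ℝ ℝ) (y, w)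
  hasDerivAt_space : ∀ y w, 0 ≤ y → HasDerivAt (Kw y) (Kww y w) w
  continuous_time : ∀ y, 0 ≤ y → Continuous (Kx y)
  abs_time_le : ∀ y w, 0 ≤ y → |Kx y w| ≤ B
  abs_space_le : ∀ y w, 0 ≤ y → |Kw y w| ≤ B
  abs_space_space_le : ∀ y w, 0 ≤ y → |Kww y w| ≤ B
  drift_nonneg : ∀ y w, 0 ≤ y → 0 ≤ 2 * Kx y w + Kww y w

namespace IsHeatSubsolution

variable {K Kx Kw Kww : ℝ → ℝ → ℝ} {B x : ℝ}

/- Moving `x` by `v ^ 2` and `w` by `v * ξ` keeps the path differentiable at `v = 0`, which the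
parametrisation by the variance `v ^ 2` would not. -/
theorem hasDerivAt_path (hK : IsHeatSubsolution K Kx Kw Kww B) (hx : 0 ≤ x) (w ξ v : ℝ) :
    HasDerivAt (fun v => K (x + v ^ 2) (w + v * ξ))
      (2 * v * Kx (x + v ^ 2) (w + v * ξ) + ξ * Kw (x + v ^ 2) (w + v * ξ)) v := by
  have htime : HasDerivAt (fun v : ℝ => x + v ^ 2) (2 * v) v := by
    simpa using (hasDerivAt_pow 2 v).const_add x
  have hspace : HasDerivAt (fun v : ℝ => w + v * ξ) ξ v := by
    simpa using ((hasDerivAt_id v).mul_const ξ).const_add w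
  refine ((hK.hasFDerivAt (x + v ^ 2) (w + v * ξ) (by positivity)).comp_hasDerivAt v
    (htime.prodMk hspace)).congr_deriv ?_
  simp [mul_comm]

theorem abs_deriv_path_le (hK : IsHeatSubsolution K Kx Kw Kww B) (hx : 0 ≤ x) (w ξ : ℝ)
    {v R : ℝ} (hv : |v| ≤ R) :
    |2 * v * Kx (x + v ^ 2) (w + v * ξ) + ξ * Kw (x + v ^ 2) (w + v * ξ)| ≤
      2 * R * B + |ξ| * B := by
  have hy : 0 ≤ x + v ^ 2 := by positivity
  have hR : 0 ≤ R := (abs_nonneg v).trans hv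
  refine (abs_add_le _ _).trans ?_
  rw [abs_mul, abs_mul, abs_mul, abs_two]
  gcongr
  · exact hK.abs_time_le _ _ hy
  · exact hK.abs_space_le _ _ hy

theorem continuous (hK : IsHeatSubsolution K Kx Kw Kww B) {y : ℝ} (hy : 0 ≤ y) :
    Continuous (K y) :=
  continuous_iff_continuousAt.2 fun w => ContinuousAt.comp (f := fun w => (y, w))
    (hK.hasFDerivAt y w hy).continuousAt (by fun_prop)

theorem continuous_space (hK : IsHeatSubsolution K Kx Kw Kww B) {y : ℝ} (hy : 0 ≤ y) :
    Continuous (Kw y) :=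
  continuous_iff_continuousAt.2 fun w => (hK.hasDerivAt_space y w hy).continuousAt

theorem integrable_path (hK : IsHeatSubsolution K Kx Kw Kww B) (hx : 0 ≤ x) (w v : ℝ) :
    Integrable (fun ξ => K (x + v ^ 2) (w + v * ξ)) (gaussianReal 0 1) := by
  have hbound : Integrable (fun ξ : ℝ => |K x w| + (2 * |v| * B + |ξ| * B) * |v|)
      (gaussianReal 0 1) := (integrable_const _).add
    (((integrable_const _).add (integrable_abs_gaussianReal.mul_const B)).mul_const _)
  have hmeas : Continuous fun ξ => K (x + v ^ 2) (w + v * ξ) :=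
    (hK.continuous (by positivity)).comp (by fun_prop)
  refine hbound.mono' hmeas.aestronglyMeasurable (ae_of_all _ fun ξ => ?_)
  have hincrement := (convex_Icc (-|v|) |v|).norm_image_sub_le_of_norm_hasDerivWithin_le
    (x := 0) (y := v) (fun u _ => (hK.hasDerivAt_path hx w ξ u).hasDerivWithinAt)
    (fun u hu => hK.abs_deriv_path_le hx w ξ (abs_le.2 hu))
    ⟨by simp, by simp⟩ ⟨neg_abs_le v, le_abs_self v⟩
  simp only [Real.norm_eq_abs, sub_zero, ne_eq, OfNat.ofNat_ne_zero, not_false_eq_true, zero_pow,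
    add_zero, zero_mul] at hincrement
  rw [Real.norm_eq_abs]
  linarith [abs_sub_abs_le_abs_sub (K (x + v ^ 2) (w + v * ξ)) (K x w)]

theorem hasDerivAt_integral_path (hK : IsHeatSubsolution K Kx Kw Kww B) (hx : 0 ≤ x)
    (w v : ℝ) :
    HasDerivAt (fun v => ∫ ξ, K (x + v ^ 2) (w + v * ξ) ∂(gaussianReal 0 1))
      (∫ ξ, (2 * v * Kx (x + v ^ 2) (w + v * ξ) + ξ * Kw (x + v ^ 2) (w + v * ξ))
        ∂(gaussianReal 0 1)) v := by
  have hy : 0 ≤ x + v ^ 2 := by positivity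
  have hderiv_cont : Continuous fun ξ =>
      2 * v * Kx (x + v ^ 2) (w + v * ξ) + ξ * Kw (x + v ^ 2) (w + v * ξ) :=
    (((hK.continuous_time _ hy).comp (by fun_prop)).const_mul _).add
      (continuous_id.mul ((hK.continuous_space hy).comp (by fun_prop)))
  refine (hasDerivAt_integral_of_dominated_loc_of_deriv_le (Metric.ball_mem_nhds v one_pos)
    (Filter.Eventually.of_forall fun u => (hK.integrable_path hx w u).aestronglyMeasurable)
    (hK.integrable_path hx w v) hderiv_cont.aestronglyMeasurable
    (ae_of_all _ fun ξ u hu => hK.abs_deriv_path_le hx w ξ (R := |v| + 1) ?_)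
    ((integrable_const _).add (integrable_abs_gaussianReal.mul_const B))
    (ae_of_all _ fun ξ u _ => hK.hasDerivAt_path hx w ξ u)).2
  rw [Metric.mem_ball, Real.dist_eq] at hu
  linarith [abs_sub_abs_le_abs_sub u v]

theorem integrable_time_path (hK : IsHeatSubsolution K Kx Kw Kww B) (hx : 0 ≤ x) (w v : ℝ) :
    Integrable (fun ξ => Kx (x + v ^ 2) (w + v * ξ)) (gaussianReal 0 1) :=
  .of_bound ((hK.continuous_time _ (by positivity)).comp (by fun_prop)).aestronglyMeasurable B
    (ae_of_all _ fun _ => hK.abs_time_le _ _ (by positivity))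

theorem integrable_space_path (hK : IsHeatSubsolution K Kx Kw Kww B) (hx : 0 ≤ x) (w v : ℝ) :
    Integrable (fun ξ => Kw (x + v ^ 2) (w + v * ξ)) (gaussianReal 0 1) :=
  .of_bound ((hK.continuous_space (by positivity)).comp (by fun_prop)).aestronglyMeasurable B
    (ae_of_all _ fun _ => hK.abs_space_le _ _ (by positivity))

theorem integrable_mul_space_path (hK : IsHeatSubsolution K Kx Kw Kww B) (hx : 0 ≤ x)
    (w v : ℝ) : Integrable (fun ξ => ξ * Kw (x + v ^ 2) (w + v * ξ)) (gaussianReal 0 1) :=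
  ((memLp_id_gaussianReal 1).integrable le_rfl).mul_bdd
    (hK.integrable_space_path hx w v).aestronglyMeasurable
    (ae_of_all _ fun _ => hK.abs_space_le _ _ (by positivity))

theorem integrable_space_space_path (hK : IsHeatSubsolution K Kx Kw Kww B) (hx : 0 ≤ x)
    (w v : ℝ) : Integrable (fun ξ => Kww (x + v ^ 2) (w + v * ξ)) (gaussianReal 0 1) := by
  have hy : 0 ≤ x + v ^ 2 := by positivity
  have hmeas : Measurable (Kww (x + v ^ 2)) :=
    funext (fun y => (hK.hasDerivAt_space _ y hy).deriv) ▸ measurable_deriv _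
  exact .of_bound (hmeas.comp (by fun_prop)).aestronglyMeasurable B
    (ae_of_all _ fun _ => hK.abs_space_space_le _ _ hy)

theorem integral_mul_space_path (hK : IsHeatSubsolution K Kx Kw Kww B) (hx : 0 ≤ x) (w v : ℝ) :
    ∫ ξ, ξ * Kw (x + v ^ 2) (w + v * ξ) ∂(gaussianReal 0 1) =
      ∫ ξ, v * Kww (x + v ^ 2) (w + v * ξ) ∂(gaussianReal 0 1) := by
  have hderiv : ∀ ξ, HasDerivAt (fun ξ => Kw (x + v ^ 2) (w + v * ξ))
      (v * Kww (x + v ^ 2) (w + v * ξ)) ξ := fun ξ => by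
    have hline : HasDerivAt (fun ξ => w + v * ξ) v ξ := by
      simpa using ((hasDerivAt_id ξ).const_mul v).const_add w
    exact ((hK.hasDerivAt_space _ _ (by positivity)).comp ξ hline).congr_deriv (mul_comm _ _)
  have hparts := integral_sub_mul_gaussianReal (μ := 0) (v := 1) hderiv
    (hK.integrable_space_path hx w v) ((hK.integrable_space_space_path hx w v).const_mul v)
    (by simpa only [sub_zero] using hK.integrable_mul_space_path hx w v)
  simpa only [sub_zero, NNReal.coe_one, one_mul] using hparts

theorem integral_deriv_path_nonneg (hK : IsHeatSubsolution K Kx Kw Kww B) (hx : 0 ≤ x)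
    (w : ℝ) {v : ℝ} (hv : 0 ≤ v) :
    0 ≤ ∫ ξ, (2 * v * Kx (x + v ^ 2) (w + v * ξ) + ξ * Kw (x + v ^ 2) (w + v * ξ))
      ∂(gaussianReal 0 1) := by
  have htime := (hK.integrable_time_path hx w v).const_mul (2 * v)
  rw [integral_add htime (hK.integrable_mul_space_path hx w v), hK.integral_mul_space_path hx,
    ← integral_add htime ((hK.integrable_space_space_path hx w v).const_mul v)]
  refine integral_nonneg fun ξ => ?_
  have hdrift := mul_nonneg hv (hK.drift_nonneg (x + v ^ 2) (w + v * ξ) (by positivity))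
  exact hdrift.trans_eq (by ring)

theorem le_integral_gaussianReal (hK : IsHeatSubsolution K Kx Kw Kww B) (hx : 0 ≤ x)
    (w v : ℝ) : K x w ≤ ∫ ξ, K (x + v ^ 2) (w + v * ξ) ∂(gaussianReal 0 1) := by
  wlog hv : 0 ≤ v generalizing v
  · have hsymm : ∫ ξ, K (x + v ^ 2) (w + v * ξ) ∂((gaussianReal 0 1).map fun ξ => -ξ) =
        ∫ ξ, K (x + (-v) ^ 2) (w + -v * ξ) ∂(gaussianReal 0 1) :=
      ((Homeomorph.neg ℝ).measurableEmbedding.integral_map _).trans (by simp)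
    rw [gaussianReal_map_neg, neg_zero] at hsymm
    exact hsymm ▸ this (-v) (by linarith)
  have hmono : MonotoneOn (fun v => ∫ ξ, K (x + v ^ 2) (w + v * ξ) ∂(gaussianReal 0 1))
      (Set.Ici 0) := by
    refine monotoneOn_of_deriv_nonneg (convex_Ici 0)
      (fun u _ => (hK.hasDerivAt_integral_path hx w u).continuousAt.continuousWithinAt)
      (fun u _ => (hK.hasDerivAt_integral_path hx w u).differentiableAt.differentiableWithinAt)
      fun u hu => ?_
    rw [(hK.hasDerivAt_integral_path hx w u).deriv]
    exact hK.integral_deriv_path_nonneg hx w (interior_subset hu)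
  simpa using hmono Set.self_mem_Ici hv hv

end IsHeatSubsolution

section Certificate

/-- The least value over `u` of `a * (u - 1) ^ 2 / 2 + b * (u + 1) ^ 2 / 2 + lam * u ^ 2`, expressed
through `C = (a + b) / 2` and `q = a * b`. Up to normalisation it is the Bayes risk, for squared
loss, of estimating `1`, `-1` or `0` from data of likelihoods `a`, `b`, `1` and prior weights `1/2`,
`1/2`, `lam`. -/
noncomputable def posteriorRisk (lam C q : ℝ) : ℝ :=
  (lam * C + q) / (lam + C)

theorem sq_mul_posteriorRisk_le {lam a b : ℝ} (hlam : 0 < lam) (ha : 0 < a) (hb : 0 < b)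
    (u ρ : ℝ) :
    ρ ^ 2 * posteriorRisk lam ((a + b) / 2) (a * b) ≤
      a * (u - ρ) ^ 2 / 2 + b * (u + ρ) ^ 2 / 2 + lam * u ^ 2 := by
  rw [posteriorRisk, mul_div_assoc', div_le_iff₀ (by positivity)]
  linear_combination sq_nonneg ((lam + (a + b) / 2) * u - ρ * ((a - b) / 2))

/-- The value at `C = (L₊ + L₋) / 2`, `q = L₊ L₋` of the function of two likelihood ratios whose
logarithm bounds the posterior risk from below. The coefficients make it an approximate solution
of the corresponding optimal stopping problem. -/
noncomputable def certificate (C q : ℝ) : ℝ :=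
  C + q * (19 / 10 - 17 / 50 * q)

theorem log_le_div_sub_one_add_log_two {z m : ℝ} {k : ℤ} (hz : 0 < z) (hm : 0 < m)
    (hmk : m ^ 2 ≤ 2 ^ k) : Real.log z ≤ z / m - 1 + k / 2 * Real.log 2 := by
  have hlog_m : 2 * Real.log m ≤ k * Real.log 2 := by
    have := Real.log_le_log (by positivity) hmk
    rwa [Real.log_pow, Real.log_zpow, Nat.cast_ofNat] at this
  have hlog_div := Real.log_le_sub_one_of_pos (div_pos hz hm)
  rw [Real.log_div hz.ne' hm.ne'] at hlog_div
  linarith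

theorem certificate_pos {C q : ℝ} (hC : 0 < C) (hq : 0 ≤ q) (hq1 : q ≤ 1) :
    0 < certificate C q := by
  have : 0 ≤ 19 / 10 - 17 / 50 * q := by linarith
  unfold certificate
  positivity

/- The logarithm is replaced by its tangent at a point `m` close to a half-integral power of `2`,
which leaves a polynomial inequality, valid for `C` in an interval around that point. -/
theorem certificate_le_posteriorRisk_of_tangent {C q : ℝ} (hC : 0 < C) (hq : 0 ≤ q)
    (hq1 : q ≤ 1) {k : ℤ} {m : ℝ} (hm : 0 < m) (hmk : m ^ 2 ≤ 2 ^ k)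
    (h : (711 / 1000 + (certificate C q / (64 / 25) / m - 1 + k / 2 * Real.log 2) / 4 -
      13 / 2000 * (C - 1)) * (6 / 5 + C) ≤ 6 / 5 * C + q) :
    711 / 1000 + Real.log (certificate C q / (64 / 25)) / 4 - 13 / 2000 * (C - 1) ≤
      posteriorRisk (6 / 5) C q := by
  rw [posteriorRisk, le_div_iff₀ (by positivity)]
  refine le_trans ?_ h
  gcongr
  exact log_le_div_sub_one_add_log_two (div_pos (certificate_pos hC hq hq1) (by norm_num)) hm hmk

theorem certificate_le_posteriorRisk {C q : ℝ} (hC : 0 < C) (hq : 0 ≤ q) (hq1 : q ≤ 1)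
    (hqC : q ≤ C ^ 2) :
    711 / 1000 + Real.log (certificate C q / (64 / 25)) / 4 - 13 / 2000 * (C - 1) ≤
      posteriorRisk (6 / 5) C q := by
  have hlog_lower := mul_nonneg (sub_nonneg.2 Real.log_two_gt_d9.le) (by linarith : 0 ≤ 6 / 5 + C)
  have hlog_upper := mul_nonneg (sub_nonneg.2 Real.log_two_lt_d9.le) (by linarith : 0 ≤ 6 / 5 + C)
  have hqC' := mul_nonneg hq hC.le
  have of_tangent (k : ℤ) (m : ℝ) (hm : 0 < m) (hmk : m ^ 2 ≤ 2 ^ k) :=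
    certificate_le_posteriorRisk_of_tangent hC hq hq1 hm hmk
  unfold certificate at of_tangent ⊢
  rcases le_or_gt C (27 / 100) with h1 | h1
  · refine of_tangent (-6) (1 / 8) (by norm_num) (by norm_num) ?_
    push_cast
    nlinarith
  rcases le_or_gt C (33 / 100) with h2 | h2
  · refine of_tangent (-5) (1767 / 10000) (by norm_num) (by norm_num) ?_
    push_cast
    nlinarith
  rcases le_or_gt C (1 / 2) with h3 | h3
  · refine of_tangent (-4) (1 / 4) (by norm_num) (by norm_num) ?_
    push_cast
    nlinarith [mul_nonneg (sub_nonneg.2 hqC) (sub_nonneg.2 h3), mul_nonneg hq (sub_nonneg.2 h3)]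
  rcases le_or_gt C (6 / 5) with h4 | h4
  · refine of_tangent (-3) (3535 / 10000) (by norm_num) (by norm_num) ?_
    push_cast
    nlinarith [mul_nonneg hq hq]
  rcases le_or_gt C 5 with h5 | h5
  · refine of_tangent 0 1 (by norm_num) (by norm_num) ?_
    push_cast
    nlinarith
  rcases le_or_gt C 12 with h6 | h6
  · refine of_tangent 3 (2828 / 1000) (by norm_num) (by norm_num) ?_
    push_cast
    nlinarith
  rcases le_or_gt C 28 with h7 | h7
  · refine of_tangent 6 8 (by norm_num) (by norm_num) ?_
    push_cast
    nlinarith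
  · refine of_tangent 8 16 (by norm_num) (by norm_num) ?_
    push_cast
    nlinarith

end Certificate

section HeatCertificate

/-- The profile `A` such that `certificate C (s ^ 2) = s * (c + A s)` for `C = s * c`. -/
noncomputable def profile (s : ℝ) : ℝ := 19 / 10 * s - 17 / 50 * s ^ 3

/-- The Euler derivative `s * A' s` of the profile. -/
noncomputable def profileEuler (s : ℝ) : ℝ := 19 / 10 * s - 51 / 50 * s ^ 3

theorem certificate_eq (s c : ℝ) : certificate (s * c) (s ^ 2) = s * (c + profile s) := by
  unfold certificate profile
  ring

theorem hasDerivAt_profile_exp (y : ℝ) :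
    HasDerivAt (fun y => profile (Real.exp (-(y / 2))))
      (-(profileEuler (Real.exp (-(y / 2))) / 2)) y := by
  have hexp : HasDerivAt (fun y : ℝ => Real.exp (-(y / 2))) (Real.exp (-(y / 2)) * -(1 / 2)) y :=
    ((hasDerivAt_id y).div_const 2).neg.exp
  refine ((hexp.const_mul (19 / 10)).sub ((hexp.pow 3).const_mul (17 / 50))).congr_deriv ?_
  unfold profileEuler
  ring

variable {s : ℝ}

theorem profileEuler_nonneg (h0 : 0 ≤ s) (h1 : s ≤ 1) : 0 ≤ profileEuler s := by
  have := mul_nonneg h0 (sub_nonneg.2 (pow_le_one₀ h0 h1 : s ^ 2 ≤ 1))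
  unfold profileEuler
  linarith

theorem profileEuler_le_one (h0 : 0 ≤ s) : profileEuler s ≤ 1 := by
  have := mul_nonneg (by linarith : 0 ≤ s + 197 / 125) (sq_nonneg (s - 197 / 250))
  unfold profileEuler
  linarith

theorem profileEuler_le_profile (h0 : 0 ≤ s) : profileEuler s ≤ profile s := by
  have := pow_nonneg h0 3
  unfold profileEuler profile
  linarith

theorem exp_neg_half_le_one {y : ℝ} (hy : 0 ≤ y) : Real.exp (-(y / 2)) ≤ 1 :=
  Real.exp_le_one_iff.2 (by linarith)

theorem profile_exp_nonneg {y : ℝ} (hy : 0 ≤ y) : 0 ≤ profile (Real.exp (-(y / 2))) :=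
  (profileEuler_nonneg (Real.exp_pos _).le (exp_neg_half_le_one hy)).trans
    (profileEuler_le_profile (Real.exp_pos _).le)

/-- The logarithm of `certificate` at likelihood ratios `L₊ = exp (w - y / 2)` and
`L₋ = exp (-w - y / 2)`, up to the linear term `-y / 2`. -/
noncomputable def heatCertificate (y w : ℝ) : ℝ :=
  Real.log (Real.cosh w + profile (Real.exp (-(y / 2))))

theorem cosh_add_profile_pos {y : ℝ} (hy : 0 ≤ y) (w : ℝ) :
    0 < Real.cosh w + profile (Real.exp (-(y / 2))) :=
  add_pos_of_pos_of_nonneg (Real.cosh_pos w) (profile_exp_nonneg hy)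

theorem log_certificate_eq {y : ℝ} (hy : 0 ≤ y) (w : ℝ) :
    Real.log (certificate (Real.exp (-(y / 2)) * Real.cosh w) (Real.exp (-y))) =
      heatCertificate y w - y / 2 := by
  have hsq : Real.exp (-y) = Real.exp (-(y / 2)) ^ 2 := by
    rw [← Real.exp_nat_mul]
    ring_nf
  rw [hsq, certificate_eq, Real.log_mul (Real.exp_ne_zero _) (cosh_add_profile_pos hy w).ne',
    Real.log_exp, heatCertificate]
  ring

theorem heatCertificate_zero_zero : heatCertificate 0 0 = Real.log (64 / 25) := by
  norm_num [heatCertificate, profile]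

theorem abs_heatCertificate_le {y : ℝ} (hy : 0 ≤ y) (w : ℝ) :
    |heatCertificate y w| ≤ 3 * Real.cosh w := by
  have hone : 1 ≤ Real.cosh w + profile (Real.exp (-(y / 2))) :=
    le_add_of_le_of_nonneg (Real.one_le_cosh w) (profile_exp_nonneg hy)
  have hprofile : profile (Real.exp (-(y / 2))) ≤ 2 := by
    have := exp_neg_half_le_one hy
    have := pow_pos (Real.exp_pos (-(y / 2))) 3
    unfold profile
    linarith
  rw [heatCertificate, abs_of_nonneg (Real.log_nonneg hone)]
  linarith [Real.log_le_sub_one_of_pos (cosh_add_profile_pos hy w), Real.one_le_cosh w]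

theorem measurable_heatCertificate : Measurable (Function.uncurry heatCertificate) := by
  unfold heatCertificate profile Function.uncurry
  fun_prop

theorem hasFDerivAt_heatCertificate {y : ℝ} (hy : 0 ≤ y) (w : ℝ) :
    HasFDerivAt (Function.uncurry heatCertificate)
      (-(profileEuler (Real.exp (-(y / 2))) /
          (2 * (Real.cosh w + profile (Real.exp (-(y / 2)))))) • ContinuousLinearMap.fst ℝ ℝ ℝ +
        (Real.sinh w / (Real.cosh w + profile (Real.exp (-(y / 2))))) •
          ContinuousLinearMap.snd ℝ ℝ ℝ) (y, w) := by
  have hpos := cosh_add_profile_pos hy w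
  have hsum := ((Real.hasDerivAt_cosh w).comp_hasFDerivAt (y, w)
    (hasFDerivAt_snd (𝕜 := ℝ) (E := ℝ) (F := ℝ))).add
    ((hasDerivAt_profile_exp y).comp_hasFDerivAt (y, w)
    (hasFDerivAt_fst (𝕜 := ℝ) (E := ℝ) (F := ℝ)))
  refine (hsum.log hpos.ne').congr_fderiv ?_
  ext <;> simp <;> field_simp

theorem drift_formula_nonneg {c A D : ℝ} (hc : 1 ≤ c) (hA : 0 ≤ A) (hD : D ≤ 1) (hDA : D ≤ A) :
    0 ≤ 2 * -(D / (2 * (c + A))) + (1 + c * A) / (c + A) ^ 2 := by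
  have hne : c + A ≠ 0 := by linarith
  have hdrift : 2 * -(D / (2 * (c + A))) + (1 + c * A) / (c + A) ^ 2 =
      ((1 + A) * (1 - D) + (c - 1) * (A - D)) / (c + A) ^ 2 := by
    field_simp [hne]
    ring
  rw [hdrift]
  exact div_nonneg (add_nonneg (mul_nonneg (by linarith) (by linarith))
    (mul_nonneg (by linarith) (by linarith))) (sq_nonneg _)

theorem isHeatSubsolution_heatCertificate :
    IsHeatSubsolution heatCertificate
      (fun y w => -(profileEuler (Real.exp (-(y / 2))) /
        (2 * (Real.cosh w + profile (Real.exp (-(y / 2)))))))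
      (fun y w => Real.sinh w / (Real.cosh w + profile (Real.exp (-(y / 2)))))
      (fun y w => (1 + Real.cosh w * profile (Real.exp (-(y / 2)))) /
        (Real.cosh w + profile (Real.exp (-(y / 2)))) ^ 2) 1 where
  hasFDerivAt _ w hy := hasFDerivAt_heatCertificate hy w
  hasDerivAt_space y w hy := by
    have hpos := cosh_add_profile_pos hy w
    refine ((Real.hasDerivAt_sinh w).div ((Real.hasDerivAt_cosh w).add_const _)
      hpos.ne').congr_deriv ?_
    congr 1
    linarith [Real.cosh_sq w]
  continuous_time y hy := by
    have := fun w => (cosh_add_profile_pos hy w).ne'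
    fun_prop (disch := simpa)
  abs_time_le y w hy := by
    have hpos := cosh_add_profile_pos hy w
    have hD := profileEuler_nonneg (Real.exp_pos (-(y / 2))).le (exp_neg_half_le_one hy)
    rw [abs_neg, abs_of_nonneg (by positivity), div_le_one (by positivity)]
    linarith [profileEuler_le_profile (Real.exp_pos (-(y / 2))).le, Real.cosh_pos w]
  abs_space_le y w hy := by
    have hpos := cosh_add_profile_pos hy w
    rw [abs_div, abs_of_pos hpos, div_le_one hpos]
    have := abs_le_of_sq_le_sq (by linarith [Real.cosh_sq w] : Real.sinh w ^ 2 ≤ Real.cosh w ^ 2)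
      (Real.cosh_pos w).le
    linarith [profile_exp_nonneg hy]
  abs_space_space_le y w hy := by
    have hpos := cosh_add_profile_pos hy w
    have hA := profile_exp_nonneg hy
    have hc := Real.one_le_cosh w
    rw [abs_of_nonneg (by positivity), div_le_one (by positivity)]
    nlinarith [mul_nonneg hA (Real.cosh_pos w).le]
  drift_nonneg y w hy :=
    drift_formula_nonneg (Real.one_le_cosh w) (profile_exp_nonneg hy)
      (profileEuler_le_one (Real.exp_pos _).le) (profileEuler_le_profile (Real.exp_pos _).le)

end HeatCertificate

section ChangeOfMeasure

variable {m : ℕ} {Ω : Type*} [MeasurableSpace Ω] (alg : Algorithm m Ω)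
  (θ v : EuclideanSpace ℝ (Fin m)) (t : ℕ)

/-- The sum over the rounds of the noise under the parameter `θ` times the component of the action
along `v`: the martingale part of the log-likelihood ratio of `θ + v` to `θ`. -/
noncomputable def score : (t : ℕ) → Ω × (Fin t → ℝ) → ℝ
  | 0, _ => 0
  | t + 1, p => score t (p.1, Fin.init p.2) +
      inner ℝ (alg.action t p.1 (Fin.init p.2)) v *
        (p.2 (Fin.last t) - inner ℝ (alg.action t p.1 (Fin.init p.2)) θ)

/-- The sum over the rounds of the squared component of the action along `v`: the quadratic
variation of `score`. -/
noncomputable def energy : (t : ℕ) → Ω × (Fin t → ℝ) → ℝ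
  | 0, _ => 0
  | t + 1, p => energy t (p.1, Fin.init p.2) + inner ℝ (alg.action t p.1 (Fin.init p.2)) v ^ 2

/-- The density of the law of `t` rounds under `θ + v` with respect to the law under `θ`. -/
noncomputable def likelihoodRatio (p : Ω × (Fin t → ℝ)) : ℝ :=
  Real.exp (score alg θ v t p - energy alg v t p / 2)

theorem score_step (p : Ω × (Fin t → ℝ)) (ξ : ℝ) :
    score alg θ v (t + 1) (step alg θ t (p, ξ)) =
      score alg θ v t p + inner ℝ (alg.action t p.1 p.2) v * ξ := by
  simp [score, step]

theorem energy_step (p : Ω × (Fin t → ℝ)) (ξ : ℝ) :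
    energy alg v (t + 1) (step alg θ t (p, ξ)) =
      energy alg v t p + inner ℝ (alg.action t p.1 p.2) v ^ 2 := by
  simp [energy, step]

theorem likelihoodRatio_step (p : Ω × (Fin t → ℝ)) (ξ : ℝ) :
    likelihoodRatio alg θ v (t + 1) (step alg θ t (p, ξ)) =
      likelihoodRatio alg θ v t p * Real.exp (inner ℝ (alg.action t p.1 p.2) v * ξ -
        inner ℝ (alg.action t p.1 p.2) v ^ 2 / 2) := by
  rw [likelihoodRatio, likelihoodRatio, ← Real.exp_add, score_step, energy_step]
  ring_nf

theorem step_add_param (p : Ω × (Fin t → ℝ)) (ξ : ℝ) :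
    step alg (θ + v) t (p, ξ) = step alg θ t (p, ξ + inner ℝ (alg.action t p.1 p.2) v) := by
  simp only [step, inner_add_right]
  ring_nf

theorem score_neg (p : Ω × (Fin t → ℝ)) : score alg θ (-v) t p = -score alg θ v t p := by
  induction t with
  | zero => simp [score]
  | succ t ih => simp only [score, ih, inner_neg_right]; ring

theorem energy_neg (p : Ω × (Fin t → ℝ)) : energy alg (-v) t p = energy alg v t p := by
  induction t with
  | zero => simp [energy]
  | succ t ih => simp only [energy, ih, inner_neg_right, neg_sq]

theorem abs_inner_action_le (ω : Ω) (y : Fin t → ℝ) :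
    |(inner ℝ (alg.action t ω y) v : ℝ)| ≤ ‖v‖ :=
  (abs_real_inner_le_norm _ _).trans
    (mul_le_of_le_one_left (norm_nonneg _) (alg.norm_action_le t ω y))

theorem inner_action_sq_le (ω : Ω) (y : Fin t → ℝ) :
    (inner ℝ (alg.action t ω y) v : ℝ) ^ 2 ≤ ‖v‖ ^ 2 :=
  sq_le_sq.2 ((abs_inner_action_le alg v t ω y).trans (le_abs_self _))

theorem energy_nonneg (p : Ω × (Fin t → ℝ)) : 0 ≤ energy alg v t p := by
  induction t with
  | zero => simp [energy]
  | succ t ih => exact add_nonneg (ih _) (sq_nonneg _)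

theorem energy_le (p : Ω × (Fin t → ℝ)) : energy alg v t p ≤ t * ‖v‖ ^ 2 := by
  induction t with
  | zero => simp [energy]
  | succ t ih =>
    rw [Nat.cast_succ, add_one_mul]
    exact add_le_add (ih _) (inner_action_sq_le alg v t _ _)

theorem measurable_inner_action :
    Measurable fun p : Ω × (Fin t → ℝ) => (inner ℝ (alg.action t p.1 p.2) v : ℝ) :=
  (alg.measurable_action t).inner measurable_const

theorem measurable_forget_last :
    Measurable fun p : Ω × (Fin (t + 1) → ℝ) => (p.1, Fin.init p.2) :=
  measurable_fst.prodMk (measurable_pi_lambda _ fun i =>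
    (measurable_pi_apply i.castSucc).comp measurable_snd)

theorem measurable_score : Measurable (score alg θ v t) := by
  induction t with
  | zero => exact measurable_const
  | succ t ih =>
    exact (ih.comp (measurable_forget_last t)).add
      (((measurable_inner_action alg v t).comp (measurable_forget_last t)).mul
        (((measurable_pi_apply (Fin.last t)).comp measurable_snd).sub
          ((measurable_inner_action alg θ t).comp (measurable_forget_last t))))

theorem measurable_energy : Measurable (energy alg v t) := by
  induction t with
  | zero => exact measurable_const
  | succ t ih =>
    exact (ih.comp (measurable_forget_last t)).add
      (((measurable_inner_action alg v t).comp (measurable_forget_last t)).pow_const 2)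

theorem measurable_likelihoodRatio : Measurable (likelihoodRatio alg θ v t) :=
  ((measurable_score alg θ v t).sub ((measurable_energy alg v t).div_const 2)).exp

theorem likelihoodRatio_pos (p : Ω × (Fin t → ℝ)) : 0 < likelihoodRatio alg θ v t p :=
  Real.exp_pos _

theorem lintegral_interactionLaw_succ {f : Ω × (Fin (t + 1) → ℝ) → ENNReal}
    (hf : Measurable f) :
    ∫⁻ p, f p ∂(interactionLaw alg θ (t + 1)) =
      ∫⁻ p, ∫⁻ ξ, f (step alg θ t (p, ξ)) ∂(gaussianReal 0 1) ∂(interactionLaw alg θ t) := by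
  have hstep := measurable_step alg θ t
  rw [interactionLaw, lintegral_map hf hstep, lintegral_prod (fun z => f (step alg θ t z))
    (hf.comp hstep).aemeasurable]

theorem lintegral_step_add {f : Ω × (Fin (t + 1) → ℝ) → ENNReal} (hf : Measurable f)
    (p : Ω × (Fin t → ℝ)) :
    ∫⁻ ξ, f (step alg (θ + v) t (p, ξ)) ∂(gaussianReal 0 1) =
      ∫⁻ ξ, ENNReal.ofReal (Real.exp (inner ℝ (alg.action t p.1 p.2) v * ξ -
        inner ℝ (alg.action t p.1 p.2) v ^ 2 / 2)) * f (step alg θ t (p, ξ))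
          ∂(gaussianReal 0 1) := by
  have hstep : Measurable fun ξ : ℝ => step alg θ t (p, ξ) :=
    (measurable_step alg θ t).comp measurable_prodMk_left
  simp only [step_add_param]
  rw [lintegral_gaussianReal_comp_add_const (F := fun ξ => f (step alg θ t (p, ξ))) one_ne_zero _
    (hf.comp hstep)]
  simp

theorem lintegral_interactionLaw_add {f : Ω × (Fin t → ℝ) → ENNReal} (hf : Measurable f) :
    ∫⁻ p, f p ∂(interactionLaw alg (θ + v) t) =
      ∫⁻ p, ENNReal.ofReal (likelihoodRatio alg θ v t p) * f p ∂(interactionLaw alg θ t) := by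
  induction t with
  | zero => simp [interactionLaw, likelihoodRatio, score, energy]
  | succ t ih =>
    have hratio := (measurable_likelihoodRatio alg θ v (t + 1)).ennreal_ofReal
    have hinner := (measurable_inner_action alg v t).comp
      (measurable_fst : Measurable (Prod.fst : (Ω × (Fin t → ℝ)) × ℝ → _))
    have hintegrand : Measurable fun z : (Ω × (Fin t → ℝ)) × ℝ =>
        ENNReal.ofReal (Real.exp (inner ℝ (alg.action t z.1.1 z.1.2) v * z.2 -
          inner ℝ (alg.action t z.1.1 z.1.2) v ^ 2 / 2)) * f (step alg θ t z) :=
      (((hinner.mul measurable_snd).sub ((hinner.pow_const 2).div_const 2)).exp.ennreal_ofReal).mul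
        (hf.comp (measurable_step alg θ t))
    rw [lintegral_interactionLaw_succ alg _ t hf,
      lintegral_interactionLaw_succ alg θ t (f := fun p =>
        ENNReal.ofReal (likelihoodRatio alg θ v (t + 1) p) * f p) (hratio.mul hf)]
    simp only [lintegral_step_add alg θ v t hf]
    rw [ih hintegrand.lintegral_prod_right']
    refine lintegral_congr fun p => (lintegral_const_mul _
      (hintegrand.comp measurable_prodMk_left)).symm.trans (lintegral_congr fun ξ => ?_)
    rw [likelihoodRatio_step, ENNReal.ofReal_mul (likelihoodRatio_pos alg θ v t p).le, mul_assoc,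
      Function.comp_apply]

theorem interactionLaw_add :
    interactionLaw alg (θ + v) t = (interactionLaw alg θ t).withDensity fun p =>
      ENNReal.ofReal (likelihoodRatio alg θ v t p) := by
  refine Measure.ext_of_lintegral _ fun f hf => ?_
  rw [lintegral_interactionLaw_add alg θ v t hf, lintegral_withDensity_eq_lintegral_mul _
    (measurable_likelihoodRatio alg θ v t).ennreal_ofReal hf]
  rfl

theorem integral_interactionLaw_add (g : Ω × (Fin t → ℝ) → ℝ) :
    ∫ p, g p ∂(interactionLaw alg (θ + v) t) =
      ∫ p, likelihoodRatio alg θ v t p * g p ∂(interactionLaw alg θ t) := by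
  rw [interactionLaw_add, integral_withDensity_eq_integral_toReal_smul
    (measurable_likelihoodRatio alg θ v t).ennreal_ofReal
    (ae_of_all _ fun _ => ENNReal.ofReal_lt_top)]
  simp only [ENNReal.toReal_ofReal (likelihoodRatio_pos alg θ v t _).le, smul_eq_mul]

theorem integral_likelihoodRatio :
    ∫ p, likelihoodRatio alg θ v t p ∂(interactionLaw alg θ t) = 1 := by
  simpa using (integral_interactionLaw_add alg θ v t fun _ => 1).symm

theorem integrable_likelihoodRatio :
    Integrable (likelihoodRatio alg θ v t) (interactionLaw alg θ t) :=
  .of_integral_ne_zero (integral_likelihoodRatio alg θ v t ▸ one_ne_zero)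

theorem integral_interactionLaw_succ {f : Ω × (Fin (t + 1) → ℝ) → ℝ}
    (hf : Integrable f (interactionLaw alg θ (t + 1))) :
    ∫ p, f p ∂(interactionLaw alg θ (t + 1)) =
      ∫ p, ∫ ξ, f (step alg θ t (p, ξ)) ∂(gaussianReal 0 1) ∂(interactionLaw alg θ t) := by
  have hstep := measurable_step alg θ t
  rw [interactionLaw] at hf ⊢
  rw [integral_map hstep.aemeasurable hf.aestronglyMeasurable]
  exact integral_prod _ (hf.comp_aemeasurable hstep.aemeasurable)

theorem integrable_integral_step {f : Ω × (Fin (t + 1) → ℝ) → ℝ}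
    (hf : Integrable f (interactionLaw alg θ (t + 1))) :
    Integrable (fun p => ∫ ξ, f (step alg θ t (p, ξ)) ∂(gaussianReal 0 1))
      (interactionLaw alg θ t) := by
  rw [interactionLaw] at hf
  exact (hf.comp_aemeasurable (measurable_step alg θ t).aemeasurable).integral_prod_left

theorem integrable_energy (θ' : EuclideanSpace ℝ (Fin m)) :
    Integrable (energy alg v t) (interactionLaw alg θ' t) :=
  .of_bound (measurable_energy alg v t).aestronglyMeasurable (t * ‖v‖ ^ 2)
    (ae_of_all _ fun p => by
      rw [Real.norm_eq_abs, abs_of_nonneg (energy_nonneg alg v t p)]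
      exact energy_le alg v t p)

theorem integrable_inner_action :
    Integrable (fun p => (inner ℝ (alg.action t p.1 p.2) v : ℝ)) (interactionLaw alg θ t) :=
  .of_bound (measurable_inner_action alg v t).aestronglyMeasurable ‖v‖
    (ae_of_all _ fun p => abs_inner_action_le alg v t p.1 p.2)

theorem integrable_inner_action_sq :
    Integrable (fun p => (inner ℝ (alg.action t p.1 p.2) v : ℝ) ^ 2) (interactionLaw alg θ t) :=
  .of_bound ((measurable_inner_action alg v t).pow_const 2).aestronglyMeasurable (‖v‖ ^ 2)
    (ae_of_all _ fun p => by
      rw [Real.norm_eq_abs, abs_sq]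
      exact inner_action_sq_le alg v t p.1 p.2)

theorem integral_energy :
    ∫ p, energy alg v t p ∂(interactionLaw alg θ t) = ∑ s ∈ Finset.range t,
      ∫ p, (inner ℝ (alg.action s p.1 p.2) v : ℝ) ^ 2 ∂(interactionLaw alg θ s) := by
  induction t with
  | zero => simp [energy]
  | succ t ih =>
    rw [integral_interactionLaw_succ alg θ t (integrable_energy alg v _ θ), Finset.sum_range_succ,
      ← ih, ← integral_add (integrable_energy alg v t θ) (integrable_inner_action_sq alg θ v t)]
    simp [energy_step]

theorem regretAgainst_step (b : EuclideanSpace ℝ (Fin m)) (p : Ω × (Fin t → ℝ)) (ξ : ℝ) :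
    regretAgainst alg θ b (t + 1) (step alg θ t (p, ξ)) =
      regretAgainst alg θ b t p + inner ℝ θ (b - alg.action t p.1 p.2) := by
  have hprefix {k : ℕ} (hk : k ≤ t) (c : ℝ) :
      (fun i : Fin k => (Fin.snoc p.2 c : Fin (t + 1) → ℝ) (Fin.castLE (hk.trans t.le_succ) i)) =
        fun i => p.2 (Fin.castLE hk i) :=
    funext fun i => Fin.snoc_castSucc (α := fun _ => ℝ) _ _ (Fin.castLE hk i)
  simp only [regretAgainst, Fin.sum_univ_castSucc, actionAt, step]
  congr 1
  · exact Finset.sum_congr rfl fun s _ => by simp only [Fin.val_castSucc, hprefix s.is_lt.le]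
  · simp only [Fin.val_last, hprefix le_rfl]
    rfl

theorem integral_regretAgainst (b : EuclideanSpace ℝ (Fin m)) :
    ∫ p, regretAgainst alg θ b t p ∂(interactionLaw alg θ t) =
      ∑ s ∈ Finset.range t, ∫ p, inner ℝ θ (b - alg.action s p.1 p.2)
        ∂(interactionLaw alg θ s) := by
  induction t with
  | zero => simp [regretAgainst]
  | succ t ih =>
    have hround : Integrable (fun p => inner ℝ θ (b - alg.action t p.1 p.2))
        (interactionLaw alg θ t) := by
      simp only [inner_sub_right, ← real_inner_comm θ (alg.action t _ _)]
      exact (integrable_const _).sub (integrable_inner_action alg θ θ t)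
    rw [integral_interactionLaw_succ alg θ t (integrable_regretAgainst alg θ b (t + 1)),
      Finset.sum_range_succ, ← ih, ← integral_add (integrable_regretAgainst alg θ b t) hround]
    simp [regretAgainst_step]

end ChangeOfMeasure

section BayesRisk

variable {m : ℕ} {Ω : Type*} [MeasurableSpace Ω] (alg : Algorithm m Ω)
  (θ v : EuclideanSpace ℝ (Fin m)) (t : ℕ)

/-- The density, with respect to the law of `t` rounds under `θ`, of the balanced mixture of the
laws under `θ + v` and `θ - v`. -/
noncomputable def meanLikelihood (p : Ω × (Fin t → ℝ)) : ℝ :=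
  Real.exp (-(energy alg v t p / 2)) * Real.cosh (score alg θ v t p)

theorem meanLikelihood_eq (p : Ω × (Fin t → ℝ)) : meanLikelihood alg θ v t p =
    (likelihoodRatio alg θ v t p + likelihoodRatio alg θ (-v) t p) / 2 := by
  rw [meanLikelihood, likelihoodRatio, likelihoodRatio, Real.cosh_eq, score_neg, energy_neg,
    sub_eq_add_neg, sub_eq_add_neg, Real.exp_add, Real.exp_add]
  ring

theorem likelihoodRatio_mul_neg (p : Ω × (Fin t → ℝ)) :
    likelihoodRatio alg θ v t p * likelihoodRatio alg θ (-v) t p =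
      Real.exp (-energy alg v t p) := by
  rw [likelihoodRatio, likelihoodRatio, ← Real.exp_add, score_neg, energy_neg]
  ring_nf

theorem meanLikelihood_pos (p : Ω × (Fin t → ℝ)) : 0 < meanLikelihood alg θ v t p :=
  mul_pos (Real.exp_pos _) (Real.cosh_pos _)

theorem measurable_meanLikelihood : Measurable (meanLikelihood alg θ v t) :=
  ((measurable_energy alg v t).div_const 2).neg.exp.mul
    (Real.continuous_cosh.measurable.comp (measurable_score alg θ v t))

theorem integrable_meanLikelihood :
    Integrable (meanLikelihood alg θ v t) (interactionLaw alg θ t) := by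
  rw [funext (meanLikelihood_eq alg θ v t)]
  exact ((integrable_likelihoodRatio alg θ v t).add
    (integrable_likelihoodRatio alg θ (-v) t)).div_const 2

theorem integral_meanLikelihood :
    ∫ p, meanLikelihood alg θ v t p ∂(interactionLaw alg θ t) = 1 := by
  simp only [meanLikelihood_eq]
  rw [integral_div, integral_add (integrable_likelihoodRatio alg θ v t)
    (integrable_likelihoodRatio alg θ (-v) t), integral_likelihoodRatio, integral_likelihoodRatio]
  norm_num

theorem integrable_heatCertificate :
    Integrable (fun p => heatCertificate (energy alg v t p) (score alg θ v t p))
      (interactionLaw alg θ t) := by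
  have hmeas := measurable_heatCertificate.comp
    ((measurable_energy alg v t).prodMk (measurable_score alg θ v t))
  refine ((integrable_meanLikelihood alg θ v t).const_mul
    (3 * Real.exp (t * ‖v‖ ^ 2 / 2))).mono' hmeas.aestronglyMeasurable (ae_of_all _ fun p => ?_)
  have hfactor : 1 ≤ Real.exp (t * ‖v‖ ^ 2 / 2) * Real.exp (-(energy alg v t p / 2)) := by
    rw [← Real.exp_add]
    exact Real.one_le_exp (by linarith [energy_le alg v t p])
  calc |heatCertificate (energy alg v t p) (score alg θ v t p)|
      ≤ 3 * Real.cosh (score alg θ v t p) := abs_heatCertificate_le (energy_nonneg alg v t p) _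
    _ ≤ 3 * (Real.exp (t * ‖v‖ ^ 2 / 2) * Real.exp (-(energy alg v t p / 2)) *
          Real.cosh (score alg θ v t p)) := by
        gcongr
        exact le_mul_of_one_le_left (Real.cosh_pos _).le hfactor
    _ = 3 * Real.exp (t * ‖v‖ ^ 2 / 2) * meanLikelihood alg θ v t p := by
        rw [meanLikelihood]; ring

theorem log_le_integral_heatCertificate :
    Real.log (64 / 25) ≤
      ∫ p, heatCertificate (energy alg v t p) (score alg θ v t p) ∂(interactionLaw alg θ t) := by
  induction t with
  | zero => simp [energy, score, heatCertificate_zero_zero]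
  | succ t ih =>
    have hint := integrable_heatCertificate alg θ v (t + 1)
    rw [integral_interactionLaw_succ alg θ t hint]
    refine ih.trans (integral_mono (integrable_heatCertificate alg θ v t)
      (integrable_integral_step alg θ t hint) fun p => ?_)
    simpa only [energy_step, score_step] using
      isHeatSubsolution_heatCertificate.le_integral_gaussianReal (energy_nonneg alg v t p)
        (score alg θ v t p) (inner ℝ (alg.action t p.1 p.2) v)

theorem heatCertificate_le_posteriorRisk (p : Ω × (Fin t → ℝ)) :
    711 / 1000 + (heatCertificate (energy alg v t p) (score alg θ v t p) -
        energy alg v t p / 2 - Real.log (64 / 25)) / 4 -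
        13 / 2000 * (meanLikelihood alg θ v t p - 1) ≤
      posteriorRisk (6 / 5) (meanLikelihood alg θ v t p) (Real.exp (-energy alg v t p)) := by
  have hC := meanLikelihood_pos alg θ v t p
  have hq := (Real.exp_pos (-energy alg v t p)).le
  have hq1 : Real.exp (-energy alg v t p) ≤ 1 :=
    Real.exp_le_one_iff.2 (neg_nonpos.2 (energy_nonneg alg v t p))
  have hqC : Real.exp (-energy alg v t p) ≤ meanLikelihood alg θ v t p ^ 2 := by
    rw [← likelihoodRatio_mul_neg alg θ, meanLikelihood_eq]
    linarith [sq_nonneg (likelihoodRatio alg θ v t p - likelihoodRatio alg θ (-v) t p)]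
  have hlog := log_certificate_eq (energy_nonneg alg v t p) (score alg θ v t p)
  have hrisk := certificate_le_posteriorRisk hC hq hq1 hqC
  rw [Real.log_div (certificate_pos hC hq hq1).ne' (by norm_num)] at hrisk
  rw [← hlog]
  exact hrisk

theorem integrable_posteriorRisk {lam : ℝ} (hlam : 1 ≤ lam) :
    Integrable (fun p => posteriorRisk lam (meanLikelihood alg θ v t p)
      (Real.exp (-energy alg v t p))) (interactionLaw alg θ t) := by
  have hmeas : Measurable fun p => posteriorRisk lam (meanLikelihood alg θ v t p)
      (Real.exp (-energy alg v t p)) :=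
    (((measurable_meanLikelihood alg θ v t).const_mul lam).add
      (measurable_energy alg v t).neg.exp).div ((measurable_meanLikelihood alg θ v t).const_add lam)
  refine .of_bound hmeas.aestronglyMeasurable lam (ae_of_all _ fun p => ?_)
  have hC := meanLikelihood_pos alg θ v t p
  have hq := Real.exp_pos (-energy alg v t p)
  have hq1 : Real.exp (-energy alg v t p) ≤ 1 :=
    Real.exp_le_one_iff.2 (neg_nonpos.2 (energy_nonneg alg v t p))
  have hdenom : 0 < lam + meanLikelihood alg θ v t p := by linarith
  rw [posteriorRisk, Real.norm_eq_abs, abs_of_nonneg (by positivity), div_le_iff₀ hdenom]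
  nlinarith [hq]

theorem le_integral_posteriorRisk :
    711 / 1000 - (∫ p, energy alg v t p ∂(interactionLaw alg θ t)) / 8 ≤
      ∫ p, posteriorRisk (6 / 5) (meanLikelihood alg θ v t p) (Real.exp (-energy alg v t p))
        ∂(interactionLaw alg θ t) := by
  have hheat := integrable_heatCertificate alg θ v t
  have henergy := (integrable_energy alg v t θ).div_const 2
  have hmean := integrable_meanLikelihood alg θ v t
  have hgap := (hheat.sub henergy).sub (integrable_const (Real.log (64 / 25)))
  have hlog := (integrable_const (711 / 1000)).add (hgap.div_const 4)
  have hexcess := (hmean.sub (integrable_const 1)).const_mul (13 / 2000)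
  refine le_trans ?_ (integral_mono (hlog.sub hexcess)
    (integrable_posteriorRisk alg θ v t (by norm_num)) (heatCertificate_le_posteriorRisk alg θ v t))
  rw [integral_sub' hlog hexcess, integral_add' (integrable_const _) (hgap.div_const 4),
    integral_div (4 : ℝ), integral_const_mul,
    integral_sub' (hheat.sub henergy) (integrable_const _), integral_sub' hheat henergy,
    integral_sub' hmean (integrable_const _), integral_div (2 : ℝ), integral_meanLikelihood]
  simp only [integral_const, probReal_univ, smul_eq_mul, one_mul]
  linarith [log_le_integral_heatCertificate alg θ v t]

theorem integrable_likelihoodRatio_mul_sq (e : EuclideanSpace ℝ (Fin m)) (ρ : ℝ) :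
    Integrable (fun p => likelihoodRatio alg θ v t p *
      (inner ℝ (alg.action t p.1 p.2) e - ρ) ^ 2) (interactionLaw alg θ t) := by
  refine (integrable_likelihoodRatio alg θ v t).mul_bdd (c := (‖e‖ + |ρ|) ^ 2)
    (((measurable_inner_action alg e t).sub_const ρ).pow_const 2).aestronglyMeasurable
    (ae_of_all _ fun p => ?_)
  rw [Real.norm_eq_abs, abs_sq, ← sq_abs]
  gcongr
  exact (abs_sub _ _).trans (add_le_add_left (abs_inner_action_le alg e t p.1 p.2) _)

theorem two_point_risk (e : EuclideanSpace ℝ (Fin m)) (ρ : ℝ) :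
    ρ ^ 2 * (711 / 1000 - (∫ p, energy alg v t p ∂(interactionLaw alg θ t)) / 8) ≤
      (∫ p, (inner ℝ (alg.action t p.1 p.2) e - ρ) ^ 2 ∂(interactionLaw alg (θ + v) t)) / 2 +
      (∫ p, (inner ℝ (alg.action t p.1 p.2) e + ρ) ^ 2 ∂(interactionLaw alg (θ + -v) t)) / 2 +
      6 / 5 * ∫ p, (inner ℝ (alg.action t p.1 p.2) e) ^ 2 ∂(interactionLaw alg θ t) := by
  have hplus := (integrable_likelihoodRatio_mul_sq alg θ v t e ρ).div_const 2
  have hminus := (integrable_likelihoodRatio_mul_sq alg θ (-v) t e (-ρ)).div_const 2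
  have hnull := (integrable_inner_action_sq alg θ e t).const_mul (6 / 5)
  simp only [sub_neg_eq_add] at hminus
  refine (mul_le_mul_of_nonneg_left (le_integral_posteriorRisk alg θ v t) (sq_nonneg ρ)).trans ?_
  rw [integral_interactionLaw_add, integral_interactionLaw_add, ← integral_const_mul,
    ← integral_const_mul, ← integral_div, ← integral_div, ← integral_add' hplus hminus,
    ← integral_add' (hplus.add hminus) hnull]
  refine integral_mono ((integrable_posteriorRisk alg θ v t (by norm_num)).const_mul _)
    ((hplus.add hminus).add hnull) fun p => ?_
  simp only [meanLikelihood_eq, ← likelihoodRatio_mul_neg alg θ]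
  exact sq_mul_posteriorRisk_le (by norm_num) (likelihoodRatio_pos alg θ v t p)
    (likelihoodRatio_pos alg θ (-v) t p) _ ρ

end BayesRisk

section Geometry

variable {E : Type*} [NormedAddCommGroup E] [InnerProductSpace ℝ E]

theorem norm_smul_add_smul {h e : E} (hh : ‖h‖ = 1) (he : ‖e‖ = 1) (horth : inner ℝ h e = 0)
    {r : ℝ} (hr : 0 ≤ r) (σ : ℝ) : ‖r • h + (r * σ) • e‖ = r * √(1 + σ ^ 2) := by
  have hsq : ‖r • h + (r * σ) • e‖ ^ 2 = r ^ 2 * (1 + σ ^ 2) := by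
    rw [norm_add_sq_real, norm_smul, norm_smul, hh, he, real_inner_smul_left,
      real_inner_smul_right, horth, Real.norm_eq_abs, Real.norm_eq_abs, mul_one, mul_one, sq_abs,
      sq_abs]
    ring
  rw [← Real.sqrt_sq (norm_nonneg _), hsq, Real.sqrt_mul (sq_nonneg r), Real.sqrt_sq hr]

theorem one_add_half_sub_le_sqrt {x : ℝ} (hx : 0 ≤ x) : 1 + x / 2 - x ^ 2 / 8 ≤ √(1 + x) := by
  rcases le_total x 8 with hx8 | hx8
  · refine Real.le_sqrt_of_sq_le ?_
    linear_combination mul_nonneg (pow_nonneg hx 3) (sub_nonneg.2 hx8) / 64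
  · exact le_trans (by nlinarith) (Real.sqrt_nonneg _)

theorem inner_sq_add_inner_sq_le_norm_sq {h e : E} (hh : ‖h‖ = 1) (he : ‖e‖ = 1)
    (horth : inner ℝ h e = 0) (a : E) :
    (inner ℝ a h : ℝ) ^ 2 + (inner ℝ a e : ℝ) ^ 2 ≤ ‖a‖ ^ 2 := by
  have horthonormal : Orthonormal ℝ ![h, e] := by
    simp [orthonormal_vecCons_iff, hh, he, horth]
  simpa [Fin.sum_univ_two, real_inner_comm a] using
    horthonormal.sum_inner_products_le (s := Finset.univ) a

/-- An action whose component along `e` differs from `σ` pays quadratically, up to the curvature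
error `r * σ ^ 4 / 8`, because the best action has component `σ / √(1 + σ ^ 2)` along `e`. -/
theorem le_norm_sub_inner {h e a : E} (hh : ‖h‖ = 1) (he : ‖e‖ = 1) (horth : inner ℝ h e = 0)
    (ha : ‖a‖ ≤ 1) {r : ℝ} (hr : 0 ≤ r) (σ : ℝ) :
    r / 2 * (inner ℝ a e - σ) ^ 2 - r * σ ^ 4 / 8 ≤
      ‖r • h + (r * σ) • e‖ - inner ℝ a (r • h + (r * σ) • e) := by
  have hsqrt := mul_le_mul_of_nonneg_left (one_add_half_sub_le_sqrt (sq_nonneg σ)) hr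
  have hbessel := (inner_sq_add_inner_sq_le_norm_sq hh he horth a).trans
    (pow_le_one₀ (norm_nonneg a) ha)
  have hcap : (inner ℝ a h : ℝ) ≤ 1 - (inner ℝ a e : ℝ) ^ 2 / 2 := by
    linarith [sq_nonneg ((inner ℝ a h : ℝ) - 1)]
  rw [norm_smul_add_smul hh he horth hr, inner_add_right, real_inner_smul_right,
    real_inner_smul_right]
  linear_combination hsqrt + r * hcap

theorem exists_orthonormalBasis_zero_eq {d : ℕ} {h : EuclideanSpace ℝ (Fin (d + 1))}
    (hh : ‖h‖ = 1) :
    ∃ b : OrthonormalBasis (Fin (d + 1)) ℝ (EuclideanSpace ℝ (Fin (d + 1))), b 0 = h := by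
  obtain ⟨b, hb⟩ := Orthonormal.exists_orthonormalBasis_extension_of_card_eq
    (𝕜 := ℝ) (E := EuclideanSpace ℝ (Fin (d + 1))) (ι := Fin (d + 1)) (v := fun _ => h)
    (s := {0}) (by simp) ⟨fun _ => hh, Subsingleton.pairwise⟩
  exact ⟨b, hb 0 rfl⟩

theorem sum_inner_succ_sq_le {d : ℕ} (b : OrthonormalBasis (Fin (d + 1)) ℝ E) {a : E}
    (ha : ‖a‖ ≤ 1) :
    ∑ i : Fin d, (inner ℝ a (b i.succ) : ℝ) ^ 2 ≤ 2 * (1 - inner ℝ a (b 0)) := by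
  have hparseval := b.sum_sq_norm_inner_left a
  simp only [Fin.sum_univ_succ, Real.norm_eq_abs, sq_abs] at hparseval
  linarith [sq_nonneg ((inner ℝ a (b 0) : ℝ) - 1), pow_le_one₀ (norm_nonneg a) ha (n := 2)]

end Geometry

section Regret

variable {m : ℕ} {Ω : Type*} [MeasurableSpace Ω] (alg : Algorithm m Ω)
  (θ v : EuclideanSpace ℝ (Fin m))

theorem energy_smul (c : ℝ) (t : ℕ) (p : Ω × (Fin t → ℝ)) :
    energy alg (c • v) t p = c ^ 2 * energy alg v t p := by
  induction t with
  | zero => simp [energy]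
  | succ t ih => simp only [energy, ih, real_inner_smul_right]; ring

theorem monotone_integral_energy :
    Monotone fun t => ∫ p, energy alg v t p ∂(interactionLaw alg θ t) := by
  simp only [integral_energy]
  exact fun s t hst => Finset.sum_le_sum_of_subset_of_nonneg (Finset.range_mono hst)
    fun _ _ _ => integral_nonneg fun _ => sq_nonneg _

theorem inner_action_le (t : ℕ) (ω : Ω) (y : Fin t → ℝ) :
    (inner ℝ (alg.action t ω y) v : ℝ) ≤ ‖v‖ :=
  (le_abs_self _).trans (abs_inner_action_le alg v t ω y)

theorem integrable_norm_sub_inner_action (t : ℕ) :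
    Integrable (fun p => ‖v‖ - inner ℝ (alg.action t p.1 p.2) v) (interactionLaw alg θ t) :=
  (integrable_const _).sub (integrable_inner_action alg θ v t)

theorem integral_norm_sub_inner_action_nonneg (t : ℕ) :
    0 ≤ ∫ p, (‖v‖ - inner ℝ (alg.action t p.1 p.2) v) ∂(interactionLaw alg θ t) :=
  integral_nonneg fun p => sub_nonneg.2 (inner_action_le alg v t p.1 p.2)

theorem inner_optimalAction : (inner ℝ θ (optimalAction θ) : ℝ) = ‖θ‖ := by
  rw [optimalAction, real_inner_smul_right, real_inner_self_eq_norm_sq, sq, ← mul_assoc]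
  rcases eq_or_ne ‖θ‖ 0 with hzero | hzero
  · simp [hzero]
  · rw [inv_mul_cancel₀ hzero, one_mul]

theorem expectedRegret_eq (T : ℕ) : expectedRegret alg θ T = ∑ t ∈ Finset.range T,
    ∫ p, (‖θ‖ - inner ℝ (alg.action t p.1 p.2) θ) ∂(interactionLaw alg θ t) := by
  simp only [expectedRegret, integral_regretAgainst, inner_sub_right, inner_optimalAction,
    real_inner_comm θ]

theorem expectedRegret_nonneg (T : ℕ) : 0 ≤ expectedRegret alg θ T := by
  rw [expectedRegret_eq]
  exact Finset.sum_nonneg fun t _ => integral_norm_sub_inner_action_nonneg alg θ θ t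

theorem expectedHintRegret_smul {h : EuclideanSpace ℝ (Fin m)} (hh : ‖h‖ = 1) {r : ℝ}
    (hr : 0 < r) (T : ℕ) :
    expectedHintRegret alg h (r • h) T = expectedRegret alg (r • h) T := by
  rw [expectedRegret, optimalAction, norm_smul, hh, mul_one, Real.norm_of_nonneg hr.le, smul_smul,
    inv_mul_cancel₀ hr.ne', one_smul, expectedHintRegret]

/- The first action does not depend on the parameter, so it loses `2 * ‖θ‖` in total against `θ`
and `-θ`. -/
theorem two_mul_norm_le_expectedRegret_add_neg {T : ℕ} (hT : 1 ≤ T) :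
    2 * ‖θ‖ ≤ expectedRegret alg θ T + expectedRegret alg (-θ) T := by
  have hfirst (η : EuclideanSpace ℝ (Fin m)) :
      ∫ p, (‖η‖ - inner ℝ (alg.action 0 p.1 p.2) η) ∂(interactionLaw alg η 0) ≤
        expectedRegret alg η T := by
    rw [expectedRegret_eq]
    exact Finset.single_le_sum (f := fun t => ∫ p, (‖η‖ - inner ℝ (alg.action t p.1 p.2) η)
      ∂(interactionLaw alg η t)) (fun t _ => integral_norm_sub_inner_action_nonneg alg η η t)
      (Finset.mem_range.2 hT)
  refine le_trans (le_of_eq ?_) (add_le_add (hfirst θ) (hfirst (-θ)))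
  rw [show interactionLaw alg (-θ) 0 = interactionLaw alg θ 0 from rfl,
    ← integral_add (integrable_norm_sub_inner_action alg θ θ 0)
      (integrable_norm_sub_inner_action alg θ (-θ) 0)]
  simp [inner_neg_right, two_mul]

theorem interactionLaw_absolutelyContinuous (θ' : EuclideanSpace ℝ (Fin m)) (t : ℕ) :
    interactionLaw alg θ' t ≪ interactionLaw alg θ t := by
  have hlaw := interactionLaw_add alg θ (θ' - θ) t
  rw [add_sub_cancel] at hlaw
  rw [hlaw]
  exact withDensity_absolutelyContinuous _ _

theorem expectedRegret_neg_of_eq_zero {T : ℕ} (hzero : expectedRegret alg θ T = 0) :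
    expectedRegret alg (-θ) T = T * (2 * ‖θ‖) := by
  rw [expectedRegret_eq, Finset.sum_eq_zero_iff_of_nonneg
    fun t _ => integral_norm_sub_inner_action_nonneg alg θ θ t] at hzero
  have hround : ∀ t ∈ Finset.range T, ∫ p, (‖-θ‖ - inner ℝ (alg.action t p.1 p.2) (-θ))
      ∂(interactionLaw alg (-θ) t) = 2 * ‖θ‖ := by
    intro t ht
    have hint := integrable_norm_sub_inner_action alg θ θ t
    have hnonneg : (0 : Ω × (Fin t → ℝ) → ℝ) ≤ fun p => ‖θ‖ - inner ℝ (alg.action t p.1 p.2) θ :=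
      fun p => sub_nonneg.2 (inner_action_le alg θ t p.1 p.2)
    have hoptimal : (fun p => ‖θ‖ - inner ℝ (alg.action t p.1 p.2) θ)
        =ᵐ[interactionLaw alg θ t] 0 :=
      (integral_eq_zero_iff_of_nonneg hnonneg hint).1 (hzero t ht)
    have hopposite : (fun p => ‖-θ‖ - inner ℝ (alg.action t p.1 p.2) (-θ))
        =ᵐ[interactionLaw alg (-θ) t] fun _ => 2 * ‖θ‖ := by
      filter_upwards [(interactionLaw_absolutelyContinuous alg θ (-θ) t).ae_eq hoptimal] with p hp
      rw [norm_neg, inner_neg_right, ← sub_eq_zero.1 hp]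
      ring
    simpa using integral_congr_ae hopposite
  rw [expectedRegret_eq, Finset.sum_congr rfl hround, Finset.sum_const, Finset.card_range,
    nsmul_eq_mul]

theorem integrable_inner_action_sub_sq (σ : ℝ) (t : ℕ) :
    Integrable (fun p => (inner ℝ (alg.action t p.1 p.2) v - σ) ^ 2) (interactionLaw alg θ t) := by
  simp only [sub_sq]
  exact ((integrable_inner_action_sq alg θ v t).sub
    (((integrable_inner_action alg θ v t).const_mul 2).mul_const σ)).add (integrable_const _)

theorem le_expectedRegret {h e : EuclideanSpace ℝ (Fin m)} (hh : ‖h‖ = 1) (he : ‖e‖ = 1)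
    (horth : inner ℝ h e = 0) {r : ℝ} (hr : 0 ≤ r) (σ : ℝ) (T : ℕ) :
    r / 2 * ∑ t ∈ Finset.range T, ∫ p, (inner ℝ (alg.action t p.1 p.2) e - σ) ^ 2
        ∂(interactionLaw alg (r • h + (r * σ) • e) t) - T * (r * σ ^ 4 / 8) ≤
      expectedRegret alg (r • h + (r * σ) • e) T := by
  set θ := r • h + (r * σ) • e
  have hround (t : ℕ) : r / 2 * ∫ p, (inner ℝ (alg.action t p.1 p.2) e - σ) ^ 2
      ∂(interactionLaw alg θ t) - r * σ ^ 4 / 8 ≤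
        ∫ p, (‖θ‖ - inner ℝ (alg.action t p.1 p.2) θ) ∂(interactionLaw alg θ t) := by
    have hsq := (integrable_inner_action_sub_sq alg θ e σ t).const_mul (r / 2)
    refine le_trans (le_of_eq ?_) (integral_mono (hsq.sub (integrable_const (r * σ ^ 4 / 8)))
      (integrable_norm_sub_inner_action alg θ θ t)
      fun p => le_norm_sub_inner hh he horth (alg.norm_action_le t p.1 p.2) hr σ)
    rw [integral_sub' hsq (integrable_const _), integral_const_mul]
    simp
  rw [expectedRegret_eq]
  refine le_trans (le_of_eq ?_) (Finset.sum_le_sum fun t _ => hround t)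
  rw [Finset.sum_sub_distrib, Finset.mul_sum, Finset.sum_const, Finset.card_range, nsmul_eq_mul]

end Regret

section Direction

variable {d : ℕ} {Ω : Type*} [MeasurableSpace Ω] (alg : Algorithm (d + 1) Ω)

theorem sum_integral_energy_le
    (b : OrthonormalBasis (Fin (d + 1)) ℝ (EuclideanSpace ℝ (Fin (d + 1)))) {r : ℝ}
    (hr : 0 ≤ r) (T : ℕ) :
    ∑ i : Fin d, r / 2 * ∫ p, energy alg (b i.succ) T p ∂(interactionLaw alg (r • b 0) T) ≤
      expectedRegret alg (r • b 0) T := by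
  simp only [integral_energy, expectedRegret_eq]
  rw [← Finset.mul_sum, Finset.sum_comm, Finset.mul_sum]
  refine Finset.sum_le_sum fun t _ => ?_
  have hsq (i : Fin d) := integrable_inner_action_sq alg (r • b 0) (b i.succ) t
  rw [← integral_finsetSum _ fun i _ => hsq i, ← integral_const_mul]
  refine integral_mono ((integrable_finsetSum _ fun i _ => hsq i).const_mul _)
    (integrable_norm_sub_inner_action alg _ _ t) fun p => ?_
  rw [norm_smul, b.norm_eq_one, Real.norm_of_nonneg hr, real_inner_smul_right]
  linear_combination r / 2 * sum_inner_succ_sq_le b (alg.norm_action_le t p.1 p.2)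

theorem exists_integral_energy_le (hd : d ≠ 0) {h : EuclideanSpace ℝ (Fin (d + 1))}
    (hh : ‖h‖ = 1) {r : ℝ} (hr : 0 ≤ r) (T : ℕ) :
    ∃ e : EuclideanSpace ℝ (Fin (d + 1)), ‖e‖ = 1 ∧ inner ℝ h e = 0 ∧
      r / 2 * ∫ p, energy alg e T p ∂(interactionLaw alg (r • h) T) ≤
        expectedRegret alg (r • h) T / d := by
  obtain ⟨b, rfl⟩ := exists_orthonormalBasis_zero_eq hh
  have : NeZero d := ⟨hd⟩
  obtain ⟨i, -, hi⟩ := Finset.exists_le_of_sum_le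
    (f := fun i : Fin d => r / 2 * ∫ p, energy alg (b i.succ) T p ∂(interactionLaw alg (r • b 0) T))
    (g := fun _ => expectedRegret alg (r • b 0) T / d) Finset.univ_nonempty (by
      rw [Finset.sum_const, Finset.card_univ, Fintype.card_fin, nsmul_eq_mul,
        mul_div_cancel₀ _ (Nat.cast_ne_zero.2 hd)]
      exact sum_integral_energy_le alg b hr T)
  exact ⟨b i.succ, b.norm_eq_one _, b.inner_eq_zero i.succ_ne_zero.symm, hi⟩

end Direction

section Perturbation

variable {m : ℕ} {Ω : Type*} [MeasurableSpace Ω] (alg : Algorithm m Ω)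

theorem sum_two_point_risk (θ v e : EuclideanSpace ℝ (Fin m)) (ρ : ℝ) (T : ℕ) :
    T * (ρ ^ 2 * (711 / 1000 - (∫ p, energy alg v T p ∂(interactionLaw alg θ T)) / 8)) ≤
      (∑ t ∈ Finset.range T, ∫ p, (inner ℝ (alg.action t p.1 p.2) e - ρ) ^ 2
        ∂(interactionLaw alg (θ + v) t)) / 2 +
      (∑ t ∈ Finset.range T, ∫ p, (inner ℝ (alg.action t p.1 p.2) e + ρ) ^ 2
        ∂(interactionLaw alg (θ + -v) t)) / 2 +
      6 / 5 * ∫ p, energy alg e T p ∂(interactionLaw alg θ T) := by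
  rw [integral_energy alg θ e, Finset.sum_div, Finset.sum_div, Finset.mul_sum,
    ← Finset.sum_add_distrib, ← Finset.sum_add_distrib, ← nsmul_eq_mul]
  refine le_trans (by rw [Finset.card_range]) (Finset.card_nsmul_le_sum (Finset.range T) _ _
    fun t ht => le_trans ?_ (two_point_risk alg θ v t e ρ))
  have hmono := monotone_integral_energy alg θ v (Finset.mem_range.1 ht).le
  gcongr

theorem le_mean_expectedRegret {h e : EuclideanSpace ℝ (Fin m)} (hh : ‖h‖ = 1) (he : ‖e‖ = 1)
    (horth : inner ℝ h e = 0) {r : ℝ} (hr : 0 ≤ r) (ρ : ℝ) {B : ℝ} (T : ℕ)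
    (henergy : r / 2 * ∫ p, energy alg e T p ∂(interactionLaw alg (r • h) T) ≤ B) :
    T * (r * ρ ^ 2 / 2 * (711 / 1000 - ρ ^ 2 / 4 - r * ρ ^ 2 * B / 4)) - 6 / 5 * B ≤
      (expectedRegret alg (r • h + (r * ρ) • e) T +
        expectedRegret alg (r • h + (r * -ρ) • e) T) / 2 := by
  have hrisk := sum_two_point_risk alg (r • h) ((r * ρ) • e) e ρ T
  have hplus := le_expectedRegret alg hh he horth hr ρ T
  have hminus := le_expectedRegret alg hh he horth hr (-ρ) T
  simp only [energy_smul, integral_const_mul] at hrisk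
  rw [show r • h + -((r * ρ) • e) = r • h + (r * -ρ) • e by module] at hrisk
  simp only [sub_neg_eq_add] at hminus
  have hbudget := mul_le_mul_of_nonneg_left henergy
    (by positivity : 0 ≤ T * (r * ρ ^ 2) ^ 2 / 8)
  linear_combination hplus / 2 + hminus / 2 + r / 2 * hrisk + 6 / 5 * henergy + hbudget

theorem exists_perturbation {h e : EuclideanSpace ℝ (Fin m)} (hh : ‖h‖ = 1) (he : ‖e‖ = 1)
    (horth : inner ℝ h e = 0) {r : ℝ} (hr : 0 < r) {B : ℝ} (T : ℕ)
    (henergy : r / 2 * ∫ p, energy alg e T p ∂(interactionLaw alg (r • h) T) ≤ B) :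
    ∃ ρ : ℝ, ρ ^ 2 ≤ 3 ∧ T * ((711 / 1000) ^ 2 / (2 * (B + 1 / r))) - 6 / 5 * B ≤
      (expectedRegret alg (r • h + (r * ρ) • e) T +
        expectedRegret alg (r • h + (r * -ρ) • e) T) / 2 := by
  have hB : 0 ≤ B := henergy.trans' (mul_nonneg (by positivity)
    (integral_nonneg fun p => energy_nonneg alg e T p))
  have hBr : 0 < r * B + 1 := by positivity
  have hρ : √(1422 / 1000 / (r * B + 1)) ^ 2 = 1422 / 1000 / (r * B + 1) :=
    Real.sq_sqrt (by positivity)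
  -- This `ρ` maximises the bound of `le_mean_expectedRegret`.
  refine ⟨√(1422 / 1000 / (r * B + 1)), ?_, ?_⟩
  · rw [hρ, div_le_iff₀ hBr]
    linarith [mul_nonneg hr.le hB]
  · convert le_mean_expectedRegret alg hh he horth hr.le _ T henergy using 2
    rw [hρ]
    field_simp
    ring

end Perturbation

section Family

theorem quarter_add_le_of_trade_off {r δ B T x M : ℝ} (hr : 4000 ≤ r) (hδ : 0 ≤ δ) (hB : 0 ≤ B)
    (hrM : r ≤ M) (hBM : B ≤ δ * M)
    (htrade : T * ((711 / 1000) ^ 2 / (2 * (B + 1 / r))) - 6 / 5 * B ≤ M)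
    (hx : 0 ≤ x) (hx1 : x ≤ 1) (hxB : x * B ≤ 1 - δ + 1 / 1000) :
    1 / 4 + T / 4 * x ≤ M := by
  by_contra! hlt
  have hr0 : 0 < r := by linarith
  have hrinv : 1 / r ≤ 1 / 4000 := one_div_le_one_div_of_le (by norm_num) hr
  have hrinv0 : 0 < 1 / r := by positivity
  have hz : x * (B + 1 / r) ≤ 1 - δ + 1 / 1000 + 1 / 4000 := by
    linarith [mul_le_mul hx1 hrinv hrinv0.le zero_le_one]
  have hpenalty : M + 6 / 5 * B ≤ M * (1 + 6 / 5 * δ) := by linarith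
  have hscaled : 2 * (711 / 1000) ^ 2 * (T / 4 * x) ≤ x * (B + 1 / r) * (M * (1 + 6 / 5 * δ)) := by
    rw [tsub_le_iff_right, ← mul_div_assoc, div_le_iff₀ (by positivity)] at htrade
    have hbound := htrade.trans (mul_le_mul_of_nonneg_right hpenalty (by positivity))
    linear_combination x / 2 * hbound
  have hM : 0 < M := by linarith
  -- In `hscaled` the left side exceeds `1.0109 * M`, the right side is at most `1.0099 * M`.
  have hconcave : (1 - δ + 1 / 1000 + 1 / 4000) * (1 + 6 / 5 * δ) ≤ 1.0099 := by
    nlinarith [sq_nonneg (δ - 1 / 12)]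
  have hright := mul_le_mul_of_nonneg_right hz (by positivity : 0 ≤ M * (1 + 6 / 5 * δ))
  have hright' := mul_le_mul_of_nonneg_left hconcave hM.le
  nlinarith

theorem div_le_quarter_add_min {d R T : ℝ} (hd : 1 ≤ d) (hdR : d ≤ R) (hT : 0 ≤ T) :
    1 / 4000 * (d * T / R) ≤ 1 / 4 + T / 4 * min 1 ((1001 / 1000 * d - 1) / R) := by
  have hR : 0 < R := by linarith
  have hmin : d / 1000 / R ≤ min 1 ((1001 / 1000 * d - 1) / R) :=
    le_min ((div_le_one hR).2 (by linarith)) (div_le_div_of_nonneg_right (by linarith) hR.le)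
  linear_combination T / 4 * hmin

variable {d : ℕ} {Ω : Type*} [MeasurableSpace Ω] (alg : Algorithm (d + 1) Ω)

/- For `d ≠ 0` the family also contains two perturbations of `r • h` along the direction orthogonal
to `h` that is explored least under `r • h`. -/
theorem exists_hard_family {h : EuclideanSpace ℝ (Fin (d + 1))} (hh : ‖h‖ = 1) {r : ℝ}
    (hr : 0 < r) (T : ℕ) :
    ∃ Θ : Finset (EuclideanSpace ℝ (Fin (d + 1))), r • h ∈ Θ ∧ -(r • h) ∈ Θ ∧
      (∀ θ ∈ Θ, r ≤ ‖θ‖ ∧ ‖θ‖ ≤ 2 * r) ∧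
      ∀ M, (∀ θ ∈ Θ, expectedRegret alg θ T ≤ M) → d ≠ 0 →
        T * ((711 / 1000) ^ 2 / (2 * (expectedRegret alg (r • h) T / d + 1 / r))) -
          6 / 5 * (expectedRegret alg (r • h) T / d) ≤ M := by
  classical
  have hnorm : ‖r • h‖ = r := by rw [norm_smul, hh, mul_one, Real.norm_of_nonneg hr.le]
  by_cases hd : d = 0
  · refine ⟨{r • h, -(r • h)}, by simp, by simp, fun θ hθ => ?_, fun _ _ hd' => absurd hd hd'⟩
    rcases Finset.mem_insert.1 hθ with rfl | hθ
    · constructor <;> linarith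
    · rw [Finset.mem_singleton.1 hθ, norm_neg]
      constructor <;> linarith
  obtain ⟨e, he, horth, henergy⟩ := exists_integral_energy_le alg hd hh hr.le T
  obtain ⟨ρ, hρ, hmean⟩ := exists_perturbation alg hh he horth hr T henergy
  have hperturbed (σ : ℝ) (hσ : σ ^ 2 ≤ 3) :
      r ≤ ‖r • h + (r * σ) • e‖ ∧ ‖r • h + (r * σ) • e‖ ≤ 2 * r := by
    rw [norm_smul_add_smul hh he horth hr.le, mul_comm 2 r]
    have hone : 1 ≤ √(1 + σ ^ 2) := Real.one_le_sqrt.2 (by linarith [sq_nonneg σ])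
    have htwo : √(1 + σ ^ 2) ≤ 2 := Real.sqrt_le_iff.2 ⟨by norm_num, by linarith⟩
    exact ⟨le_mul_of_one_le_right hr.le hone, mul_le_mul_of_nonneg_left htwo hr.le⟩
  refine ⟨{r • h, -(r • h), r • h + (r * ρ) • e, r • h + (r * -ρ) • e}, by simp, by simp, ?_,
    fun M hM _ => ?_⟩
  · simp only [Finset.mem_insert, Finset.mem_singleton]
    rintro θ (rfl | rfl | rfl | rfl)
    · constructor <;> linarith
    · rw [norm_neg]
      constructor <;> linarith
    · exact hperturbed ρ hρ
    · exact hperturbed (-ρ) (by rwa [neg_sq])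
  · linarith [hM (r • h + (r * ρ) • e) (by simp), hM (r • h + (r * -ρ) • e) (by simp)]

theorem exists_family_le_expectedRegret {h : EuclideanSpace ℝ (Fin (d + 1))} (hh : ‖h‖ = 1) {r : ℝ}
    (hr : 4000 ≤ r) {T : ℕ} (hT : 1 ≤ T) :
    ∃ Θ : Finset (EuclideanSpace ℝ (Fin (d + 1))), (∀ θ ∈ Θ, r ≤ ‖θ‖ ∧ ‖θ‖ ≤ 2 * r) ∧
      r • h ∈ Θ ∧ ∃ θ ∈ Θ,
        (expectedRegret alg (r • h) T = 0 → T * (2 * r) ≤ expectedRegret alg θ T) ∧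
        ∀ S, 0 < S → expectedRegret alg (r • h) T ≤ S →
          1 / 4 + T / 4 * min 1 ((1001 / 1000 * d - 1) / S) ≤ expectedRegret alg θ T := by
  have hr0 : 0 < r := by linarith
  have hnorm : ‖r • h‖ = r := by rw [norm_smul, hh, mul_one, Real.norm_of_nonneg hr0.le]
  obtain ⟨Θ, hplus, hminus, hΘ, htrade⟩ := exists_hard_family alg hh hr0 T
  obtain ⟨θ, hθ, hmax⟩ := Θ.exists_max_image (expectedRegret alg · T) ⟨_, hplus⟩
  have hR := expectedRegret_nonneg alg (r • h) T
  have hrM : r ≤ expectedRegret alg θ T := by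
    linarith [two_mul_norm_le_expectedRegret_add_neg alg (r • h) hT, hmax _ hplus, hmax _ hminus]
  refine ⟨Θ, hΘ, hplus, θ, hθ, fun hzero => ?_, fun S hS hRS => ?_⟩
  · rw [← hnorm, ← expectedRegret_neg_of_eq_zero alg _ hzero]
    exact hmax _ hminus
  rcases Nat.eq_zero_or_pos d with rfl | hd
  · have hmin : min 1 ((1001 / 1000 * ((0 : ℕ) : ℝ) - 1) / S) ≤ 0 :=
      (min_le_right _ _).trans (div_nonpos_of_nonpos_of_nonneg (by norm_num) hS.le)
    linarith [mul_nonpos_of_nonneg_of_nonpos (Nat.cast_nonneg (α := ℝ) T) hmin]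
  have hd1 : (1 : ℝ) ≤ d := Nat.one_le_cast.2 hd
  have hd0 : (0 : ℝ) < d := by linarith
  have hbudget : 0 ≤ (1001 / 1000 * d - 1) / S := div_nonneg (by linarith) hS.le
  refine quarter_add_le_of_trade_off hr (δ := 1 / d) (by positivity) (div_nonneg hR hd0.le) hrM ?_
    (htrade _ hmax hd.ne') (le_min zero_le_one hbudget) (min_le_left _ _) ?_
  · rw [div_mul_eq_mul_div, one_mul]
    exact div_le_div_of_nonneg_right (hmax _ hplus) hd0.le
  · rw [← mul_div_assoc, div_le_iff₀ hd0]
    calc min 1 ((1001 / 1000 * d - 1) / S) * expectedRegret alg (r • h) T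
        ≤ (1001 / 1000 * d - 1) / S * S :=
          mul_le_mul (min_le_right _ _) hRS hR hbudget
      _ = (1 - 1 / d + 1 / 1000) * d := by
        field_simp
        ring

end Family

end HintBandit

theorem mainTheorem2 :
    ∃ r₁ r₂ c : ℝ, 0 < r₁ ∧ r₁ ≤ r₂ ∧ 0 < c ∧
      ∀ (d T : ℕ), 1 ≤ T →
      ∀ h : EuclideanSpace ℝ (Fin (d + 1)), ‖h‖ = 1 →
      ∀ (Ω : Type*) [MeasurableSpace Ω] (alg : HintBandit.Algorithm (d + 1) Ω),
      ∃ (Θ : Finset (EuclideanSpace ℝ (Fin (d + 1)))) (Rh : ℝ),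
        (∀ θ ∈ Θ, r₁ ≤ ‖θ‖ ∧ ‖θ‖ ≤ r₂) ∧
        IsGreatest ((fun θ => HintBandit.expectedHintRegret alg h θ T) '' (Θ : Set _)) Rh ∧
        0 ≤ Rh ∧
        ∃ θ ∈ Θ,
          (0 < Rh →
            1 / 4 + (T : ℝ) / 4 * min 1 (((d : ℝ) - 1) / Rh)
              ≤ HintBandit.expectedRegret alg θ T) ∧
          (Rh = 0 → 1 / 4 + (T : ℝ) / 4 ≤ HintBandit.expectedRegret alg θ T) ∧
          ((d : ℝ) ≤ Rh → c * (d * T / Rh) ≤ HintBandit.expectedRegret alg θ T) := by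
  refine ⟨4000, 2 * 4000, 1 / 4000, by norm_num, by norm_num, by norm_num,
    fun d T hT h hh Ω _ alg => ?_⟩
  obtain ⟨Θ, hΘ, hhint, θ, hθ, hzero, htrade⟩ :=
    HintBandit.exists_family_le_expectedRegret alg hh le_rfl hT
  obtain ⟨η, hη, hmax⟩ := Θ.exists_max_image (HintBandit.expectedHintRegret alg h · T) ⟨_, hhint⟩
  have hR := HintBandit.expectedRegret_nonneg alg ((4000 : ℝ) • h) T
  have hRh := HintBandit.expectedHintRegret_smul alg hh (r := 4000) (by norm_num) T ▸ hmax _ hhint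
  have hT' : (1 : ℝ) ≤ T := Nat.one_le_cast.2 hT
  refine ⟨Θ, _, hΘ, ⟨Set.mem_image_of_mem _ hη, Set.forall_mem_image.2 hmax⟩, hR.trans hRh, θ, hθ,
    fun hpos => le_trans ?_ (htrade _ hpos hRh), fun hRh0 => ?_, fun hd => ?_⟩
  · gcongr
    linarith [Nat.cast_nonneg (α := ℝ) d]
  · linarith [hzero (le_antisymm (hRh.trans_eq hRh0) hR)]
  · rcases d.eq_zero_or_pos with rfl | hd0
    · simpa using HintBandit.expectedRegret_nonneg alg θ T
    have hd1 : (1 : ℝ) ≤ d := Nat.one_le_cast.2 hd0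
    exact (HintBandit.div_le_quarter_add_min hd1 hd (by positivity)).trans
      (htrade _ ((zero_lt_one.trans_le hd1).trans_le hd) hRh)
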